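/- Let $K\subset\mathbb R^2$ be a curvilinear polygon, i.e. open, bounded and simply connected with Lipschitz boundary that is a finite union of smooth arcs (the edges) with disjoint interiors; let $ds$ be arc length and $\mathbf n$ the outward unit normal on $\partial K$. Let $\mathbb P_k$ be the real polynomials on $\mathbb R^2$ of total degree $\le k$ ($\mathbb P_k=\{0\}$ for $k<0$), let $\mathbb P_m^*(\partial K)$ be the continuous functions on $\partial K$ that agree on each edge with an element of $\mathbb P_m$, and let $$V_m(K)=\{v\in H^1(K):\ \Delta v\in\mathbb P_{m-2}(K)\text{ in }K,\ v|_{\partial K}\in\mathbb P_m^*(\partial K)\},\qquad m\in\mathbb N .$$ Laplacians are taken in the sense of distributions and boundary values in the sense of traces. For $u\in H^1(K)$ with $\Delta u\in L^2(K)$ and $a\in H^1(K)$, the boundary integral $\int_{\partial K}a\,\frac{\partial u}{\partial\mathbf n}\,ds$ is in general the duality pairing of the functional $\frac{\partial u}{\partial\mathbf n}\in H^{-1/2}(\partial K)$, $\langle\frac{\partial u}{\partial\mathbf n},a\rangle=\int_K\nabla u\cdot\nabla a\,dx+\int_K\Delta u\,a\,dx$, with the trace of $a$. If $\frac{\partial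 u}{\partial\mathbf n}$ is a function in $L^2(\partial K)$ (that is, the $L^2(\partial K)$-limit of $W_k\cdot\mathbf n$ for smooth vector fields $W_k$ with $W_k\to\nabla u$ and $\operatorname{div}W_k\to\Delta u$ in $L^2(K)$), it may be read as an ordinary integral with respect to arc length. The formulas below hold with the pairings, without further assumptions; and they hold with all boundary integrals being ordinary integrals whenever the normal derivatives of $\Phi$, $v-P$, $w-Q$ that occur are functions in $L^2(\partial K)$ and $\Phi$, where it occurs, has a trace in $L^2(\partial K)$. The normal derivatives of polynomials are always the classical ones, $\nabla U\cdot\mathbf n$, in the integrals $\int_{\partial K}\frac{\partial Q^*}{\partial\mathbf n}(f-P)\,ds$, $\int_{\partial K}\frac{\partial P^*}{\partial\mathbf n}(g-Q)\,ds$, $\int_{\partial K}(f-P)\frac{\partial R}{\partial\mathbf n}\,ds$, which are ordinary integrals throughout. (i) Let $v,w\in V_m(K)$ with $\Delta v=p$, $\Delta w=q$ in $K$ for polynomials $p,q$, and $v=f$, $w=g$ on $\partial K$. Let $P,Q,P^*,Q^*$ be polynomials with $\Delta P=p$, $\Delta Q=q$, $\Delta P^*=P$, $\Delta Q^*=Q$,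 and let $\Phi\in H^1(K)$ satisfy $\Delta\Phi=v-P$ in $K$. Then $$\int_K vw\,dx=\int_{\partial K}\frac{\partial\Phi}{\partial\mathbf n}(g-Q)-\Phi\,\frac{\partial(w-Q)}{\partial\mathbf n}\,ds+\int_{\partial K}\frac{\partial Q^*}{\partial\mathbf n}(f-P)-Q^*\,\frac{\partial(v-P)}{\partial\mathbf n}\,ds+\int_{\partial K}\frac{\partial P^*}{\partial\mathbf n}(g-Q)-P^*\,\frac{\partial(w-Q)}{\partial\mathbf n}\,ds+\int_K PQ\,dx .$$ (ii) Let $v\in V_m(K)$ with $\Delta v=p$ in $K$ for a polynomial $p$ and $v=f$ on $\partial K$, and let $w=r$ be a polynomial. If $P$, $R$ are polynomials with $\Delta P=p$ and $\Delta R=r$, then $$\int_K vw\,dx=\int_{\partial K}(f-P)\frac{\partial R}{\partial\mathbf n}-R\,\frac{\partial(v-P)}{\partial\mathbf n}\,ds+\int_K Pr\,dx .$$ (iii) Let $v,w\in V_m(K)$ be harmonic in $K$, $w=g$ on $\partial K$, and let $\Phi\in H^1(K)$ satisfy $\Delta\Phi=v$ in $K$. Then $$\int_K vw\,dx=\int_{\partial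 K}\frac{\partial\Phi}{\partial\mathbf n}\,g\,ds-\int_{\partial K}\Phi\,\frac{\partial w}{\partial\mathbf n}\,ds .$$ -/

import Mathlib

open MeasureTheory Set Filter Topology Metric MvPolynomial
open scoped ContDiff NNReal ENNReal InnerProductSpace

noncomputable section

/-- The Euclidean plane `ℝ²`. -/
abbrev Plane : Type := EuclideanSpace ℝ (Fin 2)

/-! ### Polynomials -/

/-- The polynomial function `ℝ² → ℝ` defined by a bivariate real polynomial. -/
def polyFun (P : MvPolynomial (Fin 2) ℝ) : Plane → ℝ := fun x => eval (fun i => x i) P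

/-- The Laplacian `∂₁² P + ∂₂² P` of a bivariate polynomial. -/
def polyLaplacian (P : MvPolynomial (Fin 2) ℝ) : MvPolynomial (Fin 2) ℝ :=
  ∑ i, pderiv i (pderiv i P)

/-- `P` belongs to `ℙ_k`, the polynomials of total degree `≤ k`; `ℙ_k = {0}` for `k < 0`. -/
def PolyDegLE (k : ℤ) (P : MvPolynomial (Fin 2) ℝ) : Prop :=
  P = 0 ∨ (P.totalDegree : ℤ) ≤ k

/-! ### Curvilinear polygons -/

/-- A curvilinear polygon: an open, bounded, simply connected set `K ⊆ ℝ²` with Lipschitz boundary,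
the boundary being a finite union of smooth arcs (the edges) with disjoint interiors. -/
structure CurvilinearPolygon where
  /-- the cell -/
  K : Set Plane
  isOpen : IsOpen K
  isBounded : Bornology.IsBounded K
  simplyConnected : IsSimplyConnected K
  /-- Near every boundary point, and in suitable Cartesian coordinates, `K` is the region below the
  graph of a Lipschitz function. -/
  lipschitz : ∀ x ∈ frontier K, ∃ (A : Plane ≃ₗᵢ[ℝ] Plane) (g : ℝ → ℝ) (L : ℝ≥0) (r : ℝ),
    0 < r ∧ LipschitzWith L g ∧ ∀ y ∈ ball x r, (y ∈ K ↔ A y 1 < g (A y 0))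
  /-- the number of edges -/
  numEdges : ℕ
  /-- the parametrizations of the edges, on `[0, 1]` -/
  edge : Fin numEdges → ℝ → Plane
  edge_smooth : ∀ i, ContDiffOn ℝ ∞ (edge i) (Icc 0 1)
  edge_regular : ∀ i, ∀ t ∈ Icc (0 : ℝ) 1, derivWithin (edge i) (Icc 0 1) t ≠ 0
  edge_injOn : ∀ i, InjOn (edge i) (Icc 0 1)
  edge_disjoint : ∀ i j, i ≠ j → Disjoint (edge i '' Ioo 0 1) (edge j '' Ioo 0 1)
  frontier_eq : frontier K = ⋃ i, edge i '' Icc 0 1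

/-! ### Sobolev functions on an open set `K`

Functions on `K` are represented by functions on the plane; only their values almost everywhere
on `K` matter. -/

/-- Test functions on `K`: the elements of `C_c^∞(K)`. -/
def IsTestFunction (K : Set Plane) (φ : Plane → ℝ) : Prop :=
  ContDiff ℝ ∞ φ ∧ HasCompactSupport φ ∧ tsupport φ ⊆ K

/-- `G ∈ L²(K)²` is the weak gradient of `u` on `K`. -/
def HasWeakGrad (K : Set Plane) (u : Plane → ℝ) (G : Plane → Plane) : Prop :=
  MemLp G 2 (volume.restrict K) ∧
  ∀ φ, IsTestFunction K φ → ∀ e : Plane,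
    ∫ x in K, u x * fderiv ℝ φ x e = - ∫ x in K, ⟪G x, e⟫_ℝ * φ x

/-- `u ∈ H¹(K)`. -/
def MemH1 (K : Set Plane) (u : Plane → ℝ) : Prop :=
  MemLp u 2 (volume.restrict K) ∧ ∃ G, HasWeakGrad K u G

open Classical in
/-- The weak gradient `∇u` on `K` (unique almost everywhere on `K`). -/
def weakGrad (K : Set Plane) (u : Plane → ℝ) : Plane → Plane :=
  if h : ∃ G, HasWeakGrad K u G then h.choose else 0

/-- `Δu = F` on `K` in the sense of distributions, where `F ∈ L²(K)`. -/
def HasWeakLaplacian (K : Set Plane) (u F : Plane → ℝ) : Prop :=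
  MemLp F 2 (volume.restrict K) ∧
  ∀ φ, IsTestFunction K φ →
    ∫ x in K, u x * Laplacian.laplacian φ x = ∫ x in K, F x * φ x

/-- The divergence `∂₁ W₁ + ∂₂ W₂` of a differentiable vector field. -/
def divergence (W : Plane → Plane) (x : Plane) : ℝ :=
  ∑ i, (fderiv ℝ W x (EuclideanSpace.single i 1)) i

open Classical in
/-- The weak Laplacian `Δu` on `K` (unique almost everywhere on `K`). -/
def weakLaplacian (K : Set Plane) (u : Plane → ℝ) : Plane → ℝ :=
  if h : ∃ F, HasWeakLaplacian K u F then h.choose else 0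

/-! ### The outward unit normal -/

/-- `n` is the outward unit normal of `K` at `x`: it has length one, and for each `ε > 0` the points
`y` close to `x` with `n · (y - x) < -ε |y - x|` lie in `K`, those with `n · (y - x) > ε |y - x|`
do not. -/
def IsOutwardNormal (K : Set Plane) (x n : Plane) : Prop :=
  ‖n‖ = 1 ∧ ∀ ε > 0, ∀ᶠ y in 𝓝 x,
    (⟪n, y - x⟫_ℝ < -(ε * ‖y - x‖) → y ∈ K) ∧ (ε * ‖y - x‖ < ⟪n, y - x⟫_ℝ → y ∉ K)

open Classical in
/-- The outward unit normal of `K` at `x`; for a curvilinear polygon it exists at all points of the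
boundary except possibly the vertices. -/
def outwardNormal (K : Set Plane) (x : Plane) : Plane :=
  if h : ∃ n, IsOutwardNormal K x n then h.choose else 0

namespace CurvilinearPolygon

variable (Ω : CurvilinearPolygon)

/-- The arc length measure `ds` on the boundary: the sum over the edges of the images of
`|γ'(t)| dt` on `[0, 1]` under the parametrizations `γ`. -/
def arcLength : Measure Plane :=
  ∑ i, (((volume : Measure ℝ).restrict (Icc 0 1)).withDensity
    (fun t => ‖derivWithin (Ω.edge i) (Icc 0 1) t‖ₑ)).map (Ω.edge i)

/-- The classical normal derivative `∂U/∂n = ∇U · n` on the boundary, for smooth `U`. -/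
def normalDeriv (U : Plane → ℝ) (x : Plane) : ℝ := fderiv ℝ U x (outwardNormal Ω.K x)

/-- `f ∈ L²(∂K)` is the (Dirichlet) trace of `u ∈ H¹(K)` on `∂K`: it is the `L²(∂K)`-limit of the
restrictions to `∂K` of smooth functions on the plane that converge to `u` in `H¹(K)`. -/
def HasTrace (u f : Plane → ℝ) : Prop :=
  MemH1 Ω.K u ∧ MemLp f 2 Ω.arcLength ∧
  ∃ ψ : ℕ → Plane → ℝ, (∀ k, ContDiff ℝ ∞ (ψ k)) ∧
    Tendsto (fun k => eLpNorm (fun x => ψ k x - u x) 2 (volume.restrict Ω.K)) atTop (𝓝 0) ∧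
    Tendsto (fun k => eLpNorm (fun x => gradient (ψ k) x - weakGrad Ω.K u x) 2
      (volume.restrict Ω.K)) atTop (𝓝 0) ∧
    Tendsto (fun k => eLpNorm (fun x => ψ k x - f x) 2 Ω.arcLength) atTop (𝓝 0)

/-- `f ∈ ℙ_m^*(∂K)`: `f` is continuous on `∂K` and agrees on each edge with an element of `ℙ_m`. -/
def MemPStar (m : ℕ) (f : Plane → ℝ) : Prop :=
  ContinuousOn f (frontier Ω.K) ∧
  ∀ i, ∃ P, PolyDegLE m P ∧ EqOn f (polyFun P) (Ω.edge i '' Icc 0 1)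

/-- `v ∈ V_m(K)`: `v ∈ H¹(K)`, `Δv ∈ ℙ_{m-2}(K)`, and the trace of `v` on `∂K` is in
`ℙ_m^*(∂K)`. -/
def MemV (m : ℕ) (v : Plane → ℝ) : Prop :=
  MemH1 Ω.K v ∧
  (∃ p, PolyDegLE ((m : ℤ) - 2) p ∧ HasWeakLaplacian Ω.K v (polyFun p)) ∧
  ∃ f, Ω.MemPStar m f ∧ Ω.HasTrace v f

/-- The normal derivative of `u` on `∂K` is the function `h ∈ L²(∂K)`, where `u ∈ H¹(K)` and
`Δu ∈ L²(K)`: there are smooth vector fields `W` on the plane that converge to `∇u` in `L²(K)²`,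
with divergences converging to `Δu` in `L²(K)` and normal components `W · n` converging to `h` in
`L²(∂K)`. -/
def HasNormalDeriv (u h : Plane → ℝ) : Prop :=
  MemH1 Ω.K u ∧ (∃ F, HasWeakLaplacian Ω.K u F) ∧ MemLp h 2 Ω.arcLength ∧
  ∃ W : ℕ → Plane → Plane, (∀ k, ContDiff ℝ ∞ (W k)) ∧
    Tendsto (fun k => eLpNorm (fun x => W k x - weakGrad Ω.K u x) 2
      (volume.restrict Ω.K)) atTop (𝓝 0) ∧
    Tendsto (fun k => eLpNorm (fun x => divergence (W k) x - weakLaplacian Ω.K u x) 2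
      (volume.restrict Ω.K)) atTop (𝓝 0) ∧
    Tendsto (fun k => eLpNorm (fun x => ⟪W k x, outwardNormal Ω.K x⟫_ℝ - h x) 2
      Ω.arcLength) atTop (𝓝 0)

/-- The duality pairing `⟨∂u/∂n, a⟩` in `H^{-1/2}(∂K) × H^{1/2}(∂K)` of the normal derivative of `u`
with the trace of `a`, for any `u, a ∈ H¹(K)` with `Δu ∈ L²(K)`. It is the boundary integral
`∫ (∂u/∂n) a ds` in the case where `∂u/∂n` is a function in `L²(∂K)`. -/
def normalPairing (u a : Plane → ℝ) : ℝ :=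
  (∫ x in Ω.K, ⟪weakGrad Ω.K u x, weakGrad Ω.K a x⟫_ℝ) + ∫ x in Ω.K, weakLaplacian Ω.K u x * a x

end CurvilinearPolygon

end

/-! The functions `v - P` and `w - Q` are harmonic, and v w = (v - P)(w - Q) + (v - P) Q + P (w - Q)
+ P Q. Each of the first three products has a harmonic factor, and the other factor is a Laplacian,
of `Φ`, `Qs` and `Ps` respectively. Green's second identity therefore turns its integral into
boundary terms.

With duality pairings the identity is almost algebraic: the term ∫ ∇a · ∇b in ⟨∂a/∂n, b⟩ is
symmetric and cancels (`normalPairing_sub_normalPairing`). Only the almost everywhere uniqueness of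
weak derivatives enters, and the harmonic formula follows at once. The analysis lies in replacing
pairings by ordinary integrals, both for the classical normal derivatives of polynomials and for
normal derivatives in L². Both cases rest on ∫ f (W · n) ds = ∫ ∇u · W + ∫ u div W for a smooth
field `W` and an H¹ function `u` with trace `f` (`HasTrace.green`). A limit over the smooth
functions defining the trace reduces this to the divergence theorem for C¹ fields
(`integral_divergence`); a further limit over fields `W k` treats L² normal derivatives
(`HasNormalDeriv.integral_mul_eq_normalPairing`).

The divergence theorem is localized by a partition of unity. Below a Lipschitz graph it follows from
a shear, Fubini and the fundamental theorem of calculus (`integral_divergence_subgraph`). Since arc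
length is defined through the edges and the normal through `K` alone, both must be identified in
charts: the first coordinate along an edge is injective with nonzero derivative, so the change of
variables formula gives the density √(1 + g'²) (`arcLength_restrict_ball`), and Rademacher's theorem
gives the normal almost everywhere (`ae_outwardNormal_eq`). -/

/-! ### The divergence theorem below the graph of a Lipschitz function -/

/-- The shear `(s, t) ↦ (s, g s + t)` of the plane along the graph of `g`. -/
def shearHomeomorph {g : ℝ → ℝ} (hg : Continuous g) : ℝ × ℝ ≃ₜ ℝ × ℝ where
  toFun z := (z.1, g z.1 + z.2)
  invFun z := (z.1, z.2 - g z.1)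
  left_inv z := by simp
  right_inv z := by simp
  continuous_toFun := by fun_prop
  continuous_invFun := by fun_prop

theorem hasCompactSupport_comp_shear {g : ℝ → ℝ} (hg : Continuous g) {F : ℝ × ℝ → ℝ}
    (hF : HasCompactSupport F) : HasCompactSupport fun z : ℝ × ℝ => F (z.1, g z.1 + z.2) :=
  hF.comp_homeomorph (shearHomeomorph hg)

theorem integrable_comp_shear {g : ℝ → ℝ} (hg : Continuous g) {F : ℝ × ℝ → ℝ}
    (hF : Continuous F) (hF' : HasCompactSupport F) :
    Integrable (fun z : ℝ × ℝ => F (z.1, g z.1 + z.2)) :=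
  Continuous.integrable_of_hasCompactSupport (by fun_prop) (hasCompactSupport_comp_shear hg hF')

theorem setIntegral_subgraph {g : ℝ → ℝ} (hg : Continuous g) {F : ℝ × ℝ → ℝ}
    (hF : Continuous F) (hF' : HasCompactSupport F) :
    ∫ z in {z : ℝ × ℝ | z.2 < g z.1}, F z = ∫ s, ∫ t in Iio (0 : ℝ), F (s, g s + t) := by
  have hm : MeasurableSet {z : ℝ × ℝ | z.2 < g z.1} :=
    (isOpen_lt (by fun_prop) (by fun_prop)).measurableSet
  rw [← integral_indicator hm, Measure.volume_eq_prod, integral_prod]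
  · refine integral_congr_ae (.of_forall fun s => ?_)
    simp only
    rw [← integral_indicator measurableSet_Iio, ← integral_add_left_eq_self _ (g s)]
    refine integral_congr_ae (.of_forall fun t => ?_)
    simp [Set.indicator]
  · rw [← Measure.volume_eq_prod]
    exact (hF.integrable_of_hasCompactSupport hF').indicator hm

/-- Integration by parts against the constant 1. The direction is -1 because the formula reverses
the direction when it moves the derivative to the other factor. Lipschitz generality is needed
because `w₀` is restricted to translates of the graph of `g`. -/
theorem LipschitzWith.integral_deriv_eq_zero {f : ℝ → ℝ} {C : ℝ≥0} (hf : LipschitzWith C f)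
    (hf' : HasCompactSupport f) : ∫ s, deriv f s = 0 := by
  have h := integral_lineDeriv_mul_eq (μ := volume) (LipschitzWith.const (1 : ℝ)) hf hf' (-1)
  have h0 : ∀ x : ℝ, lineDeriv ℝ (fun _ : ℝ => (1 : ℝ)) x (-1) = 0 := fun x => by
    simp [lineDeriv]
  have h1 : ∀ x : ℝ, lineDeriv ℝ f x 1 = deriv f x := fun x => by
    simp [lineDeriv, smul_eq_mul, deriv_comp_const_add]
  simpa [h0, h1] using h.symm

/-- The divergence theorem below the graph of a Lipschitz function. -/
theorem integral_divergence_subgraph {g : ℝ → ℝ} {L : ℝ≥0} (hg : LipschitzWith L g)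
    {w₀ w₁ : ℝ × ℝ → ℝ} (h₀ : ContDiff ℝ 1 w₀) (h₀' : HasCompactSupport w₀)
    (h₁ : ContDiff ℝ 1 w₁) (h₁' : HasCompactSupport w₁) :
    ∫ z in {z : ℝ × ℝ | z.2 < g z.1}, (fderiv ℝ w₀ z (1, 0) + fderiv ℝ w₁ z (0, 1)) =
      ∫ s, (w₁ (s, g s) - deriv g s * w₀ (s, g s)) := by
  have hgc := hg.continuous
  have cd : ∀ {w : ℝ × ℝ → ℝ} (e : ℝ × ℝ), ContDiff ℝ 1 w → Continuous fun z => fderiv ℝ w z e :=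
    fun e h => (h.continuous_fderiv one_ne_zero).clm_apply continuous_const
  have cs : ∀ {w : ℝ × ℝ → ℝ} (e : ℝ × ℝ), HasCompactSupport w →
      HasCompactSupport fun z => fderiv ℝ w z e := fun e h => h.fderiv_apply ℝ e
  -- vertical derivatives integrate to boundary values
  have vert : ∀ {w : ℝ × ℝ → ℝ}, ContDiff ℝ 1 w → HasCompactSupport w → ∀ s,
      ∫ t in Iio (0 : ℝ), fderiv ℝ w (s, g s + t) (0, 1) = w (s, g s) := by
    intro w hw hw' s
    have hc : HasCompactSupport fun t : ℝ => w (s, g s + t) := by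
      have : Topology.IsClosedEmbedding fun t : ℝ => (s, g s + t) :=
        Function.LeftInverse.isClosedEmbedding (f := fun z : ℝ × ℝ => z.2 - g s)
          (fun t => by simp) (by fun_prop) (by fun_prop)
      exact hw'.comp_isClosedEmbedding this
    have hd : ∀ t, deriv (fun t : ℝ => w (s, g s + t)) t = fderiv ℝ w (s, g s + t) (0, 1) := by
      intro t
      have h1 : HasDerivAt (fun t : ℝ => (s, g s + t)) (0, 1) t :=
        (hasDerivAt_const t s).prodMk ((hasDerivAt_id t).const_add (g s))
      exact ((hw.differentiable one_ne_zero _).hasFDerivAt.comp_hasDerivAt t h1).deriv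
    have := HasCompactSupport.integral_Iic_deriv_eq
      (hw.comp (by fun_prop : ContDiff ℝ 1 fun t : ℝ => (s, g s + t))) hc 0
    rw [integral_Iic_eq_integral_Iio] at this
    simp only [Function.comp_def, hd, add_zero] at this
    exact this
  -- the tangential derivative integrates to zero
  have tang : ∀ t, ∫ s, (fderiv ℝ w₀ (s, g s + t) (1, 0)
      + deriv g s * fderiv ℝ w₀ (s, g s + t) (0, 1)) = 0 := by
    intro t
    obtain ⟨C, hC⟩ := ContDiff.lipschitzWith_of_hasCompactSupport h₀' h₀ one_ne_zero
    have hl : LipschitzWith (C * max 1 (L + 0)) fun s => w₀ (s, g s + t) :=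
      hC.comp (LipschitzWith.id.prodMk (hg.add (LipschitzWith.const t)))
    have hc : HasCompactSupport fun s => w₀ (s, g s + t) := by
      have : Topology.IsClosedEmbedding fun s : ℝ => (s, g s + t) :=
        Function.LeftInverse.isClosedEmbedding (f := Prod.fst) (fun _ => rfl) (by fun_prop)
          (by fun_prop)
      exact h₀'.comp_isClosedEmbedding this
    refine Eq.trans (integral_congr_ae ?_) (hl.integral_deriv_eq_zero hc)
    filter_upwards [hg.ae_differentiableAt_of_real] with s hs
    have h1 : HasDerivAt (fun s : ℝ => (s, g s + t)) (1, deriv g s) s :=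
      (hasDerivAt_id s).prodMk (hs.hasDerivAt.add_const t)
    have h2 := ((h₀.differentiable one_ne_zero _).hasFDerivAt.comp_hasDerivAt s h1).deriv
    simp only [Function.comp_def] at h2
    rw [h2, show ((1 : ℝ), deriv g s) = ((1 : ℝ), (0 : ℝ)) + deriv g s • ((0 : ℝ), (1 : ℝ)) by simp, map_add, map_smul,
      smul_eq_mul]
  have i₀ := integrable_comp_shear hgc (cd (1, 0) h₀) (cs (1, 0) h₀')
  have i₁ := integrable_comp_shear hgc (cd (0, 1) h₁) (cs (0, 1) h₁')
  have i₂ := integrable_comp_shear hgc (cd (0, 1) h₀) (cs (0, 1) h₀')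
  have i₃ : Integrable fun z : ℝ × ℝ => deriv g z.1 * fderiv ℝ w₀ (z.1, g z.1 + z.2) (0, 1) := by
    refine i₂.bdd_mul (c := L) ((measurable_deriv g).comp measurable_fst).aestronglyMeasurable
      (.of_forall fun z => ?_)
    exact norm_deriv_le_of_lipschitz hg
  have res : ∀ {F : ℝ × ℝ → ℝ}, Integrable F →
      Integrable F ((volume : Measure ℝ).prod (volume.restrict (Iio 0))) := by
    intro F hF
    have : (volume : Measure ℝ).prod (volume.restrict (Iio (0 : ℝ)))
        = (volume : Measure (ℝ × ℝ)).restrict (univ ×ˢ Iio 0) := by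
      rw [Measure.volume_eq_prod, ← Measure.prod_restrict, Measure.restrict_univ]
    rw [this]
    exact hF.restrict
  have swap : ∫ s, ∫ t in Iio (0 : ℝ), (fderiv ℝ w₀ (s, g s + t) (1, 0)
      + deriv g s * fderiv ℝ w₀ (s, g s + t) (0, 1)) = 0 := by
    rw [integral_integral_swap (f := fun s t => fderiv ℝ w₀ (s, g s + t) (1, 0)
      + deriv g s * fderiv ℝ w₀ (s, g s + t) (0, 1)) (res (i₀.add i₃))]
    simp [tang]
  rw [setIntegral_subgraph (F := fun z => fderiv ℝ w₀ z (1, 0) + fderiv ℝ w₁ z (0, 1)) hgc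
    ((cd _ h₀).add (cd _ h₁)) ((cs _ h₀').add (cs _ h₁'))]
  -- Adding g' ∂₂w₀ completes ∂₁w₀ to the derivative along the translated graph, whose double
  -- integral vanishes by `swap`. The added term integrates vertically to g' w₀ on the graph, hence
  -- the correction.
  have key : ∀ᵐ s : ℝ, ∫ t in Iio (0 : ℝ), (fderiv ℝ w₀ (s, g s + t) (1, 0)
        + fderiv ℝ w₁ (s, g s + t) (0, 1)) =
      (∫ t in Iio (0 : ℝ), (fderiv ℝ w₀ (s, g s + t) (1, 0)
        + deriv g s * fderiv ℝ w₀ (s, g s + t) (0, 1)))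
      + (w₁ (s, g s) - deriv g s * w₀ (s, g s)) := by
    filter_upwards [(res i₀).prod_right_ae, (res i₁).prod_right_ae, (res i₃).prod_right_ae]
      with s j₀ j₁ j₃
    rw [integral_add j₀ j₁, integral_add j₀ j₃, vert h₁ h₁', integral_const_mul, vert h₀ h₀']
    ring
  have iH : Integrable fun s => ∫ t in Iio (0 : ℝ), (fderiv ℝ w₀ (s, g s + t) (1, 0)
      + deriv g s * fderiv ℝ w₀ (s, g s + t) (0, 1)) := (res (i₀.add i₃)).integral_prod_left
  rw [integral_congr_ae key, integral_add iH ?_, swap, zero_add]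
  have hc : ∀ {w : ℝ × ℝ → ℝ}, ContDiff ℝ 1 w → HasCompactSupport w →
      Integrable fun s => w (s, g s) := by
    intro w hw hw'
    have : Topology.IsClosedEmbedding fun s : ℝ => (s, g s) :=
      Function.LeftInverse.isClosedEmbedding (f := Prod.fst) (fun _ => rfl) (by fun_prop)
        (by fun_prop)
    exact Continuous.integrable_of_hasCompactSupport
      (hw.continuous.comp this.continuous) (hw'.comp_isClosedEmbedding this)
  exact (hc h₁ h₁').sub ((hc h₀ h₀').bdd_mul (c := L) (measurable_deriv g).aestronglyMeasurable
    (.of_forall fun s => norm_deriv_le_of_lipschitz hg))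

/-! ### Boundary charts -/

/-- The parametrization `s ↦ (s, g s)` of a graph in the coordinates given by `A`. -/
noncomputable def graphMap (A : Plane ≃ₗᵢ[ℝ] Plane) (g : ℝ → ℝ) (s : ℝ) : Plane :=
  A.symm !₂[s, g s]

/-- The upward unit normal of a graph in the coordinates given by `A`. -/
noncomputable def graphNormal (A : Plane ≃ₗᵢ[ℝ] Plane) (g : ℝ → ℝ) (s : ℝ) : Plane :=
  (√(1 + deriv g s ^ 2))⁻¹ • A.symm !₂[-deriv g s, 1]

theorem one_le_sqrt_one_add_sq (a : ℝ) : 1 ≤ √(1 + a ^ 2) :=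
  Real.one_le_sqrt.2 (by nlinarith [sq_nonneg a])

theorem graphMap_eq_of_coord {A : Plane ≃ₗᵢ[ℝ] Plane} {g : ℝ → ℝ} {y : Plane}
    (h : A y 1 = g (A y 0)) : graphMap A g (A y 0) = y := by
  rw [graphMap, LinearIsometryEquiv.symm_apply_eq, ← h]
  ext i
  fin_cases i <;> rfl

theorem coord_graphMap (A : Plane ≃ₗᵢ[ℝ] Plane) (g : ℝ → ℝ) (s : ℝ) :
    A (graphMap A g s) 0 = s ∧ A (graphMap A g s) 1 = g s := by
  simp [graphMap]

theorem continuous_coord (A : Plane ≃ₗᵢ[ℝ] Plane) (j : Fin 2) : Continuous fun y => A y j := by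
  fun_prop

theorem continuous_graphMap (A : Plane ≃ₗᵢ[ℝ] Plane) {g : ℝ → ℝ} (hg : Continuous g) :
    Continuous (graphMap A g) := by
  refine A.symm.continuous.comp ((PiLp.continuous_toLp 2 _).comp (continuous_pi fun i => ?_))
  fin_cases i
  · exact continuous_id
  · exact hg

theorem inner_eq_coord (A : Plane ≃ₗᵢ[ℝ] Plane) (x y : Plane) :
    ⟪x, y⟫_ℝ = A x 0 * A y 0 + A x 1 * A y 1 := by
  rw [← A.inner_map_map, PiLp.inner_apply]
  simp [Fin.sum_univ_two, mul_comm]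

theorem norm_sq_eq_coord (A : Plane ≃ₗᵢ[ℝ] Plane) (x : Plane) :
    ‖x‖ ^ 2 = A x 0 ^ 2 + A x 1 ^ 2 := by
  rw [← real_inner_self_eq_norm_sq, inner_eq_coord A]; ring

theorem norm_graphNormal (A : Plane ≃ₗᵢ[ℝ] Plane) (g : ℝ → ℝ) (s : ℝ) :
    ‖graphNormal A g s‖ = 1 := by
  have h := one_le_sqrt_one_add_sq (deriv g s)
  rw [graphNormal, norm_smul, norm_inv, Real.norm_of_nonneg (Real.sqrt_nonneg _),
    LinearIsometryEquiv.norm_map, EuclideanSpace.norm_eq]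
  simp only [Fin.sum_univ_two, Matrix.cons_val_zero, Matrix.cons_val_one,
    Matrix.cons_val_fin_one, Real.norm_eq_abs, sq_abs, one_pow, neg_sq]
  rw [add_comm (deriv g s ^ 2), inv_mul_cancel₀ (by positivity)]

theorem inner_graphNormal (A : Plane ≃ₗᵢ[ℝ] Plane) (g : ℝ → ℝ) (s : ℝ) (y : Plane) :
    ⟪graphNormal A g s, y⟫_ℝ = (√(1 + deriv g s ^ 2))⁻¹ * (A y 1 - deriv g s * A y 0) := by
  rw [graphNormal, real_inner_smul_left, inner_eq_coord A]
  simp; left; ring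

theorem measurable_graphNormal (A : Plane ≃ₗᵢ[ℝ] Plane) (g : ℝ → ℝ) :
    Measurable (graphNormal A g) := by
  have h := measurable_deriv g
  refine Measurable.smul (f := fun s => (√(1 + deriv g s ^ 2))⁻¹) (by fun_prop) (A.symm.continuous.measurable.comp
    ((PiLp.continuous_toLp 2 _).measurable.comp (measurable_pi_lambda _ fun i => ?_)))
  fin_cases i
  · exact h.neg
  · exact measurable_const

theorem mem_frontier_iff_of_chart {K : Set Plane} (hK : IsOpen K) {x : Plane} {r : ℝ}
    {A : Plane ≃ₗᵢ[ℝ] Plane} {g : ℝ → ℝ} (hg : Continuous g)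
    (h : ∀ y ∈ ball x r, (y ∈ K ↔ A y 1 < g (A y 0))) {y : Plane} (hy : y ∈ ball x r) :
    y ∈ frontier K ↔ A y 1 = g (A y 0) := by
  have hc := continuous_coord A
  rw [hK.frontier_eq, Set.mem_sdiff, h y hy, not_lt]
  constructor
  · rintro ⟨h1, h2⟩
    refine le_antisymm (not_lt.1 fun h3 => ?_) h2
    have : ∀ᶠ z in 𝓝 y, z ∉ K := by
      filter_upwards [isOpen_ball.mem_nhds hy,
        (isOpen_lt (hg.comp (hc 0)) (hc 1)).mem_nhds h3] with z hz hz'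
      rw [h z hz]
      exact not_lt.2 (le_of_lt hz')
    exact (mem_closure_iff_frequently.1 h1) this
  · intro h1
    refine ⟨?_, h1.ge⟩
    -- A point of the graph is approached from inside `K` by moving straight down.
    have ht : Tendsto (fun t : ℝ => y - t • A.symm !₂[0, 1]) (𝓝[>] 0) (𝓝 y) := by
      have : Continuous fun t : ℝ => y - t • A.symm !₂[(0 : ℝ), 1] := by fun_prop
      simpa using (this.tendsto 0).mono_left nhdsWithin_le_nhds
    refine mem_closure_of_tendsto ht ?_
    filter_upwards [ht (isOpen_ball.mem_nhds hy), self_mem_nhdsWithin] with t h2 h3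
    rw [h _ h2]
    simp [h1]
    exact h3

/-- If the normals differed, a short move from `x` in the direction n' - n would end inside `K`
according to `n` and outside according to `n'`. The inner products of this direction with `n` and
`n'` are -c and c; `ε` is chosen so that the threshold is half of c. -/
theorem IsOutwardNormal.unique {K : Set Plane} {x n n' : Plane} (h : IsOutwardNormal K x n)
    (h' : IsOutwardNormal K x n') : n = n' := by
  by_contra hne
  have h1 : ⟪n, n'⟫_ℝ < 1 := inner_lt_one_iff_real_of_norm_eq_one h.1 h'.1 |>.2 hne
  set c := 1 - ⟪n, n'⟫_ℝ with hc
  have hd : 0 < ‖n' - n‖ := norm_pos_iff.2 (sub_ne_zero.2 (Ne.symm hne))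
  have e1 : ⟪n, n' - n⟫_ℝ = -c := by
    rw [inner_sub_right, real_inner_self_eq_norm_sq, h.1]; ring
  have e2 : ⟪n', n' - n⟫_ℝ = c := by
    rw [inner_sub_right, real_inner_self_eq_norm_sq, h'.1, real_inner_comm]; ring
  have hc0 : 0 < c := by linarith
  set ε := c / (2 * ‖n' - n‖) with hε
  have hε0 : 0 < ε := by positivity
  have hεc : ε * ‖n' - n‖ = c / 2 := by rw [hε]; field_simp
  have ht : Tendsto (fun t : ℝ => x + t • (n' - n)) (𝓝[>] 0) (𝓝 x) := by
    have : Continuous fun t : ℝ => x + t • (n' - n) := by fun_prop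
    simpa using (this.tendsto 0).mono_left nhdsWithin_le_nhds
  have := (ht.eventually (h.2 ε hε0)).and ((ht.eventually (h'.2 ε hε0)).and self_mem_nhdsWithin)
  obtain ⟨t, ⟨h2, -⟩, ⟨-, h3⟩, h4⟩ := this.exists
  have h4 : 0 < t := h4
  simp only [add_sub_cancel_left, norm_smul, real_inner_smul_right, e1, e2,
    Real.norm_of_nonneg h4.le] at h2 h3
  have h5 : ε * (t * ‖n' - n‖) = t * (c / 2) := by rw [← hεc]; ring
  rw [h5] at h2 h3
  exact h3 (by nlinarith) (h2 (by nlinarith))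

theorem outwardNormal_eq {K : Set Plane} {x n : Plane} (h : IsOutwardNormal K x n) :
    outwardNormal K x = n := by
  have hex : ∃ n, IsOutwardNormal K x n := ⟨n, h⟩
  rw [outwardNormal, dif_pos hex]
  exact hex.choose_spec.unique h

theorem isOutwardNormal_of_chart {K : Set Plane} {x : Plane} {r : ℝ}
    {A : Plane ≃ₗᵢ[ℝ] Plane} {g : ℝ → ℝ}
    (h : ∀ y ∈ ball x r, (y ∈ K ↔ A y 1 < g (A y 0))) {y : Plane} (hy : y ∈ ball x r)
    (hy' : A y 1 = g (A y 0)) (hd : DifferentiableAt ℝ g (A y 0)) :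
    IsOutwardNormal K y (graphNormal A g (A y 0)) := by
  refine ⟨norm_graphNormal _ _ _, fun ε hε => ?_⟩
  have h1 := (continuous_coord A 0).tendsto y
  have h2 := h1.eventually (hd.hasDerivAt.isLittleO.def hε)
  filter_upwards [isOpen_ball.mem_nhds hy, h2] with z hz hz'
  rw [h z hz, inner_graphNormal]
  have hρ := one_le_sqrt_one_add_sq (deriv g (A y 0))
  set ρ := √(1 + deriv g (A y 0) ^ 2)
  have hn : |A z 0 - A y 0| ≤ ‖z - y‖ := by
    have := norm_sq_eq_coord A (z - y)
    refine abs_le_of_sq_le_sq ?_ (norm_nonneg _)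
    rw [this]
    simp only [map_sub, PiLp.sub_apply]
    nlinarith [sq_nonneg (A z 1 - A y 1)]
  simp only [Real.norm_eq_abs, smul_eq_mul] at hz'
  have hz2 := abs_le.1 (hz'.trans (mul_le_mul_of_nonneg_left hn hε.le))
  simp only [map_sub, PiLp.sub_apply]
  rw [inv_mul_lt_iff₀ (by positivity), lt_inv_mul_iff₀ (by positivity)]
  -- Because ρ ≥ 1, the threshold multiplied by ρ still dominates the linearization error of `g`.
  have h3 : ε * ‖z - y‖ ≤ ρ * (ε * ‖z - y‖) := le_mul_of_one_le_left (by positivity) hρ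
  constructor
  · intro h4
    linarith [hz2.1]
  · intro h4
    rw [not_lt]
    linarith [hz2.2]

/-- The difference quotients of `b` are at most `L` times those of `a` in absolute value. No
differentiability of `g` is used, so the bound holds at every parameter of an edge. -/
theorem abs_deriv_le_of_eventually_eq_comp {s : Set ℝ} {a b g : ℝ → ℝ} {a' b' t : ℝ} {L : ℝ≥0}
    (hs : UniqueDiffWithinAt ℝ s t)
    (ha : HasDerivWithinAt a a' s t) (hb : HasDerivWithinAt b b' s t) (hg : LipschitzWith L g)
    (ht : b t = g (a t)) (h : ∀ᶠ u in 𝓝[s] t, b u = g (a u)) : |b'| ≤ L * |a'| := by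
  rw [hasDerivWithinAt_iff_tendsto_slope] at ha hb
  have : (𝓝[s \ {t}] t).NeBot :=
    accPt_principal_iff_nhdsWithin.1 hs.accPt
  refine le_of_tendsto_of_tendsto hb.abs (ha.abs.const_mul (L : ℝ)) ?_
  filter_upwards [nhdsWithin_mono _ sdiff_subset h] with u hu
  rw [slope_def_field, slope_def_field, abs_div, abs_div, ← mul_div_assoc, hu, ht]
  gcongr
  simpa [Real.dist_eq] using hg.dist_le_mul (a u) (a t)

/-! ### Arc length in boundary charts -/

theorem ContinuousOn.measurableSet_inter_preimage {α β : Type*} [TopologicalSpace α]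
    [MeasurableSpace α] [OpensMeasurableSpace α] [TopologicalSpace β] [MeasurableSpace β]
    [BorelSpace β] {f : α → β} {s : Set α} (hf : ContinuousOn f s) (hs : MeasurableSet s)
    {t : Set β} (ht : MeasurableSet t) : MeasurableSet (s ∩ f ⁻¹' t) := by
  have h := hs.subtype_image ((continuousOn_iff_continuous_domRestrict.1 hf).measurable ht)
  convert h using 1
  ext x
  simp [and_comm]

/-- The arc length density of a graph. -/
noncomputable def graphDensity (g : ℝ → ℝ) (s : ℝ) : ℝ≥0∞ := ENNReal.ofReal √(1 + deriv g s ^ 2)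

namespace CurvilinearPolygon

variable (Ω : CurvilinearPolygon)

/-- The part of the parameter interval of an edge that is mapped into `S`. -/
def edgePart (i : Fin Ω.numEdges) (S : Set Plane) : Set ℝ := Icc 0 1 ∩ Ω.edge i ⁻¹' S

theorem continuousOn_edge (i : Fin Ω.numEdges) : ContinuousOn (Ω.edge i) (Icc 0 1) :=
  (Ω.edge_smooth i).continuousOn

theorem measurableSet_edgePart (i : Fin Ω.numEdges) {S : Set Plane} (hS : MeasurableSet S) :
    MeasurableSet (Ω.edgePart i S) :=
  (Ω.continuousOn_edge i).measurableSet_inter_preimage measurableSet_Icc hS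

theorem continuousOn_derivWithin_edge (i : Fin Ω.numEdges) :
    ContinuousOn (derivWithin (Ω.edge i) (Icc 0 1)) (Icc 0 1) :=
  (Ω.edge_smooth i).continuousOn_derivWithin (uniqueDiffOn_Icc one_pos) (by simp)

theorem arcLength_apply {S : Set Plane} (hS : MeasurableSet S) :
    Ω.arcLength S =
      ∑ i, ∫⁻ t in Ω.edgePart i S, ‖derivWithin (Ω.edge i) (Icc 0 1) t‖ₑ := by
  rw [arcLength, Measure.finsetSum_apply]
  refine Finset.sum_congr rfl fun i _ => ?_
  rw [Measure.map_apply_of_aemeasurable, withDensity_apply', Measure.restrict_restrict'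
    measurableSet_Icc, edgePart, inter_comm]
  · exact ((Ω.continuousOn_edge i).aemeasurable measurableSet_Icc).mono_ac
      (withDensity_absolutelyContinuous _ _)
  · exact hS

theorem edge_mem_frontier (i : Fin Ω.numEdges) {t : ℝ} (ht : t ∈ Icc (0 : ℝ) 1) :
    Ω.edge i t ∈ frontier Ω.K := by
  rw [Ω.frontier_eq]
  exact mem_iUnion.2 ⟨i, mem_image_of_mem _ ht⟩

theorem arcLength_compl_frontier : Ω.arcLength (frontier Ω.K)ᶜ = 0 := by
  rw [arcLength_apply _ isClosed_frontier.measurableSet.compl]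
  refine Finset.sum_eq_zero fun i _ => ?_
  have : Ω.edgePart i (frontier Ω.K)ᶜ = ∅ := by
    ext t
    simp only [edgePart, mem_inter_iff, mem_preimage, mem_compl_iff, mem_empty_iff_false, iff_false,
      not_and, not_not]
    exact fun ht => Ω.edge_mem_frontier i ht
  simp [this]

instance : IsFiniteMeasure Ω.arcLength := by
  refine ⟨?_⟩
  rw [arcLength_apply _ MeasurableSet.univ]
  refine ENNReal.sum_lt_top.2 fun i _ => ?_
  have h : IntegrableOn (derivWithin (Ω.edge i) (Icc 0 1)) (Icc 0 1) :=
    (Ω.continuousOn_derivWithin_edge i).integrableOn_Icc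
  simpa [edgePart, HasFiniteIntegral] using h.hasFiniteIntegral

theorem ae_mem_frontier : ∀ᵐ y ∂Ω.arcLength, y ∈ frontier Ω.K :=
  Ω.arcLength_compl_frontier

section Chart

variable {Ω} {x : Plane} {r : ℝ} {A : Plane ≃ₗᵢ[ℝ] Plane} {g : ℝ → ℝ} {L : ℝ≥0}

theorem coord_edge (hg : LipschitzWith L g)
    (h : ∀ y ∈ ball x r, (y ∈ Ω.K ↔ A y 1 < g (A y 0))) {i : Fin Ω.numEdges} {t : ℝ}
    (ht : t ∈ Ω.edgePart i (ball x r)) : A (Ω.edge i t) 1 = g (A (Ω.edge i t) 0) :=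
  (mem_frontier_iff_of_chart Ω.isOpen hg.continuous h ht.2).1 (Ω.edge_mem_frontier i ht.1)

theorem injOn_coord_edge (hg : LipschitzWith L g)
    (h : ∀ y ∈ ball x r, (y ∈ Ω.K ↔ A y 1 < g (A y 0))) (i : Fin Ω.numEdges) :
    InjOn (fun t => A (Ω.edge i t) 0) (Ω.edgePart i (ball x r)) := by
  intro t ht u hu htu
  refine Ω.edge_injOn i ht.1 hu.1 ?_
  rw [← graphMap_eq_of_coord (coord_edge hg h ht), ← graphMap_eq_of_coord (coord_edge hg h hu)]
  exact congrArg _ htu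

theorem hasDerivWithinAt_coord_edge (A : Plane ≃ₗᵢ[ℝ] Plane) (j : Fin 2) {i : Fin Ω.numEdges}
    {t : ℝ} (ht : t ∈ Icc (0 : ℝ) 1) :
    HasDerivWithinAt (fun t => A (Ω.edge i t) j)
      (A (derivWithin (Ω.edge i) (Icc 0 1) t) j) (Icc 0 1) t := by
  have h1 : HasDerivWithinAt (Ω.edge i) (derivWithin (Ω.edge i) (Icc 0 1) t) (Icc 0 1) t :=
    ((Ω.edge_smooth i).differentiableOn (by simp) t ht).hasDerivWithinAt
  exact ((EuclideanSpace.proj j : Plane →L[ℝ] ℝ).comp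
    (A : Plane →L[ℝ] Plane)).hasFDerivAt.comp_hasDerivWithinAt t h1

theorem eventually_coord_edge (hg : LipschitzWith L g)
    (h : ∀ y ∈ ball x r, (y ∈ Ω.K ↔ A y 1 < g (A y 0))) {i : Fin Ω.numEdges} {t : ℝ}
    (ht : t ∈ Ω.edgePart i (ball x r)) :
    ∀ᶠ u in 𝓝[Icc 0 1] t, A (Ω.edge i u) 1 = g (A (Ω.edge i u) 0) := by
  filter_upwards [self_mem_nhdsWithin,
    Ω.continuousOn_edge i t ht.1 (isOpen_ball.mem_nhds ht.2)] with u hu hu'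
  exact coord_edge hg h ⟨hu, hu'⟩

/-- If the horizontal velocity vanished, the Lipschitz bound would make the vertical one vanish too,
against the regularity of the edge. -/
theorem coord_derivWithin_edge_ne_zero (hg : LipschitzWith L g)
    (h : ∀ y ∈ ball x r, (y ∈ Ω.K ↔ A y 1 < g (A y 0))) {i : Fin Ω.numEdges} {t : ℝ}
    (ht : t ∈ Ω.edgePart i (ball x r)) : A (derivWithin (Ω.edge i) (Icc 0 1) t) 0 ≠ 0 := by
  intro h0
  have h1 := abs_deriv_le_of_eventually_eq_comp (uniqueDiffOn_Icc one_pos t ht.1)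
    (hasDerivWithinAt_coord_edge A 0 ht.1) (hasDerivWithinAt_coord_edge A 1 ht.1) hg
    (coord_edge hg h ht) (eventually_coord_edge hg h ht)
  rw [h0, abs_zero, mul_zero] at h1
  have h2 := abs_eq_zero.1 (le_antisymm h1 (abs_nonneg _))
  have h3 := norm_sq_eq_coord A (derivWithin (Ω.edge i) (Icc 0 1) t)
  rw [h0, h2] at h3
  exact Ω.edge_regular i t ht.1 (norm_eq_zero.1 (by simpa using h3))

theorem enorm_derivWithin_edge (hg : LipschitzWith L g)
    (h : ∀ y ∈ ball x r, (y ∈ Ω.K ↔ A y 1 < g (A y 0))) {i : Fin Ω.numEdges} {t : ℝ}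
    (ht : t ∈ Ω.edgePart i (ball x r)) (hd : DifferentiableAt ℝ g (A (Ω.edge i t) 0)) :
    ‖derivWithin (Ω.edge i) (Icc 0 1) t‖ₑ =
      ENNReal.ofReal |A (derivWithin (Ω.edge i) (Icc 0 1) t) 0|
        * graphDensity g (A (Ω.edge i t) 0) := by
  have h1 : HasDerivWithinAt (fun t => A (Ω.edge i t) 1) _ (Icc 0 1) t :=
    (hd.hasDerivAt.comp_hasDerivWithinAt t
      (hasDerivWithinAt_coord_edge A 0 ht.1)).congr_of_eventuallyEq
      (eventually_coord_edge hg h ht) (coord_edge hg h ht)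
  have h2 := (uniqueDiffOn_Icc one_pos t ht.1).eq_deriv _ (hasDerivWithinAt_coord_edge A 1 ht.1) h1
  have h3 := norm_sq_eq_coord A (derivWithin (Ω.edge i) (Icc 0 1) t)
  rw [graphDensity, ← ENNReal.ofReal_mul (abs_nonneg _), ← ofReal_norm]
  congr 1
  rw [← abs_of_nonneg (norm_nonneg (derivWithin (Ω.edge i) (Icc 0 1) t)),
    ← Real.sqrt_sq_eq_abs, h3, h2, ← Real.sqrt_sq_eq_abs, ← Real.sqrt_mul (sq_nonneg _)]
  congr 1
  ring

/-- The bad parameters are mapped by the first coordinate into a set that is null by Rademacher's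
theorem. By change of variables, the absolute derivative of this coordinate has integral zero over
them; as it never vanishes there, they form a null set. -/
theorem ae_differentiableAt_coord_edge (hg : LipschitzWith L g)
    (h : ∀ y ∈ ball x r, (y ∈ Ω.K ↔ A y 1 < g (A y 0))) (i : Fin Ω.numEdges) :
    ∀ᵐ t, t ∈ Ω.edgePart i (ball x r) → DifferentiableAt ℝ g (A (Ω.edge i t) 0) := by
  set D := {s | DifferentiableAt ℝ g s} with hD
  have hDm : MeasurableSet D := measurableSet_of_differentiableAt ℝ g
  have hD0 : volume Dᶜ = 0 := hg.ae_differentiableAt_of_real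
  set B := Ω.edgePart i (ball x r ∩ (fun y => A y 0) ⁻¹' Dᶜ) with hB
  have hBm : MeasurableSet B := Ω.measurableSet_edgePart i
    (isOpen_ball.measurableSet.inter ((continuous_coord A 0).measurable hDm.compl))
  have hsub : B ⊆ Ω.edgePart i (ball x r) := fun t ht => ⟨ht.1, ht.2.1⟩
  have h1 := lintegral_image_eq_lintegral_abs_deriv_mul hBm
    (fun t ht => (hasDerivWithinAt_coord_edge A 0 ht.1).mono (fun u hu => hu.1))
    ((injOn_coord_edge hg h i).mono hsub) 1
  have h2 : (fun t => A (Ω.edge i t) 0) '' B ⊆ Dᶜ := by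
    rintro _ ⟨t, ht, rfl⟩
    exact ht.2.2
  rw [Measure.restrict_eq_zero.2 (measure_mono_null h2 hD0)] at h1
  simp only [lintegral_zero_measure, Pi.one_apply, mul_one] at h1
  have hcont : ContinuousOn (fun t => A (derivWithin (Ω.edge i) (Icc 0 1) t) 0) B :=
    ((continuous_coord A 0).comp_continuousOn (Ω.continuousOn_derivWithin_edge i)).mono
      fun t ht => ht.1
  have h3 := (lintegral_eq_zero_iff' ((hcont.aemeasurable hBm).norm.ennreal_ofReal)).1 h1.symm
  have h4 := (ae_restrict_iff' hBm).1 h3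
  filter_upwards [h4] with t ht ht'
  by_contra hn
  have := ht ⟨ht'.1, ht'.2, hn⟩
  simp only [Pi.zero_apply, ENNReal.ofReal_eq_zero, Real.norm_eq_abs] at this
  exact coord_derivWithin_edge_ne_zero hg h ht' (abs_eq_zero.1 (le_antisymm this (abs_nonneg _)))

/-- The open arcs are disjoint, so a common point is an endpoint of one of the two edges. -/
theorem finite_edge_inter {i j : Fin Ω.numEdges} (hij : i ≠ j) :
    (Ω.edge i '' Icc 0 1 ∩ Ω.edge j '' Icc 0 1).Finite := by
  have hI : ∀ t ∈ Icc (0 : ℝ) 1, t ∈ Ioo (0 : ℝ) 1 ∨ t = 0 ∨ t = 1 := by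
    intro t ht
    rcases eq_or_lt_of_le ht.1 with h | h
    · exact .inr (.inl h.symm)
    rcases eq_or_lt_of_le ht.2 with h' | h'
    · exact .inr (.inr h')
    · exact .inl ⟨h, h'⟩
  refine Set.Finite.subset (s := {Ω.edge i 0, Ω.edge i 1, Ω.edge j 0, Ω.edge j 1})
    (by simp) ?_
  rintro y ⟨⟨t, ht, rfl⟩, ⟨u, hu, huy⟩⟩
  rcases hI t ht with h | rfl | rfl
  · rcases hI u hu with h' | rfl | rfl
    · exact absurd (huy ▸ mem_image_of_mem _ h')
        (disjoint_left.1 (Ω.edge_disjoint i j hij) (mem_image_of_mem _ h))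
    · simp [huy]
    · simp [huy]
  · simp
  · simp

/-- In a boundary chart, arc length is the length measure of the graph. -/
theorem arcLength_restrict_ball (hg : LipschitzWith L g)
    (h : ∀ y ∈ ball x r, (y ∈ Ω.K ↔ A y 1 < g (A y 0))) :
    Ω.arcLength.restrict (ball x r) =
      ((volume.withDensity (graphDensity g)).map (graphMap A g)).restrict (ball x r) := by
  ext S' hS'
  rw [Measure.restrict_apply hS', Measure.restrict_apply hS']
  set S := S' ∩ ball x r with hS_def
  have hS : MeasurableSet S := hS'.inter isOpen_ball.measurableSet
  have hSb : S ⊆ ball x r := inter_subset_right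
  have hmono : ∀ i, Ω.edgePart i S ⊆ Ω.edgePart i (ball x r) := fun i t ht => ⟨ht.1, hSb ht.2⟩
  have hm := (continuous_graphMap A hg.continuous).measurable
  rw [arcLength_apply _ hS, Measure.map_apply hm hS, withDensity_apply _ (hm hS)]
  -- Inside the ball the graph is the frontier, hence the union of the edges; projecting to the
  -- first coordinate splits the graph integral into edge integrals.
  have hU : graphMap A g ⁻¹' S = ⋃ i, (fun t => A (Ω.edge i t) 0) '' Ω.edgePart i S := by
    ext s
    rw [mem_preimage, mem_iUnion]
    constructor
    · intro hs
      have hc := coord_graphMap A g s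
      have hf : graphMap A g s ∈ frontier Ω.K :=
        (mem_frontier_iff_of_chart Ω.isOpen hg.continuous h (hSb hs)).2 (by rw [hc.1, hc.2])
      rw [Ω.frontier_eq] at hf
      obtain ⟨i, t, ht, hts⟩ := mem_iUnion.1 hf
      exact ⟨i, t, ⟨ht, show Ω.edge i t ∈ S by rwa [hts]⟩, by simp only [hts, hc.1]⟩
    · rintro ⟨i, t, ht, rfl⟩
      rw [graphMap_eq_of_coord (coord_edge hg h (hmono i ht))]
      exact ht.2
  rw [hU, lintegral_iUnion₀, tsum_fintype]
  · refine Finset.sum_congr rfl fun i _ => ?_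
    rw [lintegral_image_eq_lintegral_abs_deriv_mul (Ω.measurableSet_edgePart i hS)
      (fun t ht => (hasDerivWithinAt_coord_edge A 0 ht.1).mono (fun u hu => hu.1))
      ((injOn_coord_edge hg h i).mono (hmono i))]
    refine setLIntegral_congr_fun_ae (Ω.measurableSet_edgePart i hS) ?_
    filter_upwards [ae_differentiableAt_coord_edge hg h i] with t ht ht'
    exact enorm_derivWithin_edge hg h (hmono i ht') (ht (hmono i ht'))
  · intro i
    refine (MeasurableSet.image_of_continuousOn_injOn (Ω.measurableSet_edgePart i hS) ?_
      ((injOn_coord_edge hg h i).mono (hmono i))).nullMeasurableSet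
    exact ((continuous_coord A 0).comp_continuousOn (Ω.continuousOn_edge i)).mono fun t ht => ht.1
  · intro i j hij
    -- Two projected pieces overlap only in projections of common points of the edges, since the
    -- first coordinate determines a point of the graph.
    refine Set.Finite.measure_zero (((finite_edge_inter hij).image fun y => A y 0).subset ?_) _
    rintro s ⟨⟨t, ht, rfl⟩, ⟨u, hu, hut⟩⟩
    refine ⟨Ω.edge i t, ⟨⟨t, ht.1, rfl⟩, ⟨u, hu.1, ?_⟩⟩, rfl⟩
    rw [← graphMap_eq_of_coord (coord_edge hg h (hmono i ht)),
      ← graphMap_eq_of_coord (coord_edge hg h (hmono j hu))]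
    exact congrArg _ hut

/-- In a boundary chart, the outward normal is almost everywhere the normal of the graph. -/
theorem ae_outwardNormal_eq (hg : LipschitzWith L g)
    (h : ∀ y ∈ ball x r, (y ∈ Ω.K ↔ A y 1 < g (A y 0))) :
    ∀ᵐ y ∂Ω.arcLength.restrict (ball x r),
      outwardNormal Ω.K y = graphNormal A g (A y 0) := by
  have h1 : ∀ᵐ y ∂((volume.withDensity (graphDensity g)).map (graphMap A g)),
      DifferentiableAt ℝ g (A y 0) := by
    refine (ae_map_iff (p := fun y => DifferentiableAt ℝ g (A y 0))
      (continuous_graphMap A hg.continuous).aemeasurable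
      ((continuous_coord A 0).measurable (measurableSet_of_differentiableAt ℝ g))).2 ?_
    refine (withDensity_absolutelyContinuous _ _).ae_le ?_
    filter_upwards [hg.ae_differentiableAt_of_real] with s hs
    rwa [(coord_graphMap A g s).1]
  have h2 : ∀ᵐ y ∂Ω.arcLength.restrict (ball x r), DifferentiableAt ℝ g (A y 0) := by
    rw [arcLength_restrict_ball hg h]
    exact ae_restrict_of_ae h1
  filter_upwards [h2, ae_restrict_of_ae Ω.ae_mem_frontier,
    ae_restrict_mem isOpen_ball.measurableSet] with y hy hy' hb
  exact outwardNormal_eq (isOutwardNormal_of_chart h hb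
    ((mem_frontier_iff_of_chart Ω.isOpen hg.continuous h hb).1 hy') hy)

end Chart

end CurvilinearPolygon

/-! ### The divergence theorem on a curvilinear polygon -/

/-- The linear parametrization of the plane by the coordinates given by `A`. -/
noncomputable def planeChart (A : Plane ≃ₗᵢ[ℝ] Plane) : (ℝ × ℝ) ≃L[ℝ] Plane :=
  (ContinuousLinearEquiv.finTwoArrow ℝ ℝ).symm.trans
    ((EuclideanSpace.equiv (Fin 2) ℝ).symm.trans A.symm.toContinuousLinearEquiv)

theorem planeChart_apply (A : Plane ≃ₗᵢ[ℝ] Plane) (z : ℝ × ℝ) :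
    planeChart A z = A.symm !₂[z.1, z.2] := rfl

theorem measurePreserving_planeChart (A : Plane ≃ₗᵢ[ℝ] Plane) :
    MeasurePreserving (planeChart A) :=
  A.symm.measurePreserving.comp
    ((PiLp.volume_preserving_toLp (Fin 2)).comp
      (volume_preserving_finTwoArrow ℝ).symm)

/-- The divergence is the trace of the derivative, which is the same in every orthonormal basis. -/
theorem divergence_eq_sum_coord (A : Plane ≃ₗᵢ[ℝ] Plane) (W : Plane → Plane) (x : Plane) :
    divergence W x = ∑ j, A (fderiv ℝ W x (A.symm (EuclideanSpace.single j 1))) j := by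
  have h1 := LinearMap.trace_eq_sum_inner (fderiv ℝ W x : Plane →ₗ[ℝ] Plane)
    (EuclideanSpace.basisFun (Fin 2) ℝ)
  have h2 := LinearMap.trace_eq_sum_inner (fderiv ℝ W x : Plane →ₗ[ℝ] Plane)
    ((EuclideanSpace.basisFun (Fin 2) ℝ).map A.symm)
  rw [h1] at h2
  rw [divergence]
  convert h2 using 2 with j _ j _
  · simp [EuclideanSpace.inner_single_left]
  · rw [← A.inner_map_map]
    simp [EuclideanSpace.inner_single_left]

theorem continuous_divergence {W : Plane → Plane} (hW : ContDiff ℝ 1 W) :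
    Continuous (divergence W) := by
  unfold divergence
  have := hW.continuous_fderiv one_ne_zero
  fun_prop

theorem divergence_eq_zero_of_notMem_tsupport {W : Plane → Plane} {x : Plane}
    (hx : x ∉ tsupport W) : divergence W x = 0 := by
  have h : fderiv ℝ W x = 0 := by
    by_contra hne
    exact hx (support_fderiv_subset ℝ hne)
  simp [divergence, h]

theorem divergence_planeChart (A : Plane ≃ₗᵢ[ℝ] Plane) {W : Plane → Plane}
    (hW : ContDiff ℝ 1 W) (z : ℝ × ℝ) :
    divergence W (planeChart A z) =
      fderiv ℝ (fun z => A (W (planeChart A z)) 0) z (1, 0)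
        + fderiv ℝ (fun z => A (W (planeChart A z)) 1) z (0, 1) := by
  have hd : ∀ j v, fderiv ℝ (fun z => A (W (planeChart A z)) j) z v =
      A (fderiv ℝ W (planeChart A z) (planeChart A v)) j := by
    intro j v
    have h1 : HasFDerivAt (fun z => W (planeChart A z)) _ z :=
      (hW.differentiable one_ne_zero _).hasFDerivAt.comp z (planeChart A).hasFDerivAt
    have h2 := (((EuclideanSpace.proj j : Plane →L[ℝ] ℝ).comp
      (A : Plane →L[ℝ] Plane)).hasFDerivAt.comp z h1).fderiv
    exact congrArg (fun T : ℝ × ℝ →L[ℝ] ℝ => T v) h2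
  have e0 : planeChart A (1, 0) = A.symm (EuclideanSpace.single 0 1) := by
    rw [planeChart_apply]; congr 1; ext i; fin_cases i <;> simp
  have e1 : planeChart A (0, 1) = A.symm (EuclideanSpace.single 1 1) := by
    rw [planeChart_apply]; congr 1; ext i; fin_cases i <;> simp
  rw [divergence_eq_sum_coord A, Fin.sum_univ_two, hd, hd, e0, e1]

theorem norm_outwardNormal_le (K : Set Plane) (x : Plane) : ‖outwardNormal K x‖ ≤ 1 := by
  rw [outwardNormal]
  split_ifs with h
  · exact h.choose_spec.1.le
  · simp

namespace CurvilinearPolygon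

variable {Ω : CurvilinearPolygon} {x : Plane} {r : ℝ}

/-- The divergence theorem for fields that are supported in a boundary chart. -/
theorem integral_divergence_of_chart {A : Plane ≃ₗᵢ[ℝ] Plane} {g : ℝ → ℝ} {L : ℝ≥0}
    (hg : LipschitzWith L g) (h : ∀ y ∈ ball x r, (y ∈ Ω.K ↔ A y 1 < g (A y 0)))
    {W : Plane → Plane} (hW : ContDiff ℝ 1 W) (hc : HasCompactSupport W)
    (hs : tsupport W ⊆ ball x r) :
    ∫ y in Ω.K, divergence W y = ∫ y, ⟪W y, outwardNormal Ω.K y⟫_ℝ ∂Ω.arcLength := by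
  have hW0 : ∀ y ∉ ball x r, W y = 0 := fun y hy => image_eq_zero_of_notMem_tsupport
    fun h' => hy (hs h')
  have hgm := (continuous_graphMap A hg.continuous).measurable
  have hw : ∀ j, ContDiff ℝ 1 fun z => A (W (planeChart A z)) j := fun j =>
    (((EuclideanSpace.proj j : Plane →L[ℝ] ℝ).comp (A : Plane →L[ℝ] Plane)).contDiff).comp
      (hW.comp (planeChart A).contDiff)
  have hwc : ∀ j, HasCompactSupport fun z => A (W (planeChart A z)) j := fun j =>
    HasCompactSupport.comp_left (g := fun y => A y j)
      (hc.comp_homeomorph (planeChart A).toHomeomorph) (by simp)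
  have key := integral_divergence_subgraph hg (hw 0) (hwc 0) (hw 1) (hwc 1)
  have left : ∫ y in Ω.K, divergence W y = ∫ z in {z : ℝ × ℝ | z.2 < g z.1},
      (fderiv ℝ (fun z => A (W (planeChart A z)) 0) z (1, 0)
        + fderiv ℝ (fun z => A (W (planeChart A z)) 1) z (0, 1)) := by
    have hVo : IsOpen {y | A y 1 < g (A y 0)} := isOpen_lt (continuous_coord A 1)
      (hg.continuous.comp (continuous_coord A 0))
    have h1 : ∫ y in Ω.K, divergence W y = ∫ y in {y | A y 1 < g (A y 0)}, divergence W y := by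
      rw [← integral_indicator Ω.isOpen.measurableSet, ← integral_indicator hVo.measurableSet]
      congr 1
      ext y
      by_cases hy : y ∈ ball x r
      · simp only [Set.indicator, h y hy, mem_ofPred_eq]
      · simp [Set.indicator, divergence_eq_zero_of_notMem_tsupport fun h' => hy (hs h')]
    rw [h1, ← (measurePreserving_planeChart A).setIntegral_preimage_emb
      (planeChart A).toHomeomorph.measurableEmbedding]
    have h2 : planeChart A ⁻¹' {y | A y 1 < g (A y 0)} = {z : ℝ × ℝ | z.2 < g z.1} := by
      ext z
      simp [planeChart_apply]
    rw [h2]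
    exact integral_congr_ae (.of_forall fun z => divergence_planeChart A hW z)
  -- The chart describes arc length and normal only in the ball, where `W` is supported. The
  -- restriction is removed again below, so that the integral runs over the whole graph.
  rw [left, key, ← setIntegral_eq_integral_of_forall_compl_eq_zero (s := ball x r)
    (μ := Ω.arcLength) fun y hy => by rw [hW0 y hy, inner_zero_left]]
  have right : ∫ y in ball x r, ⟪W y, outwardNormal Ω.K y⟫_ℝ ∂Ω.arcLength =
      ∫ y in ball x r, ⟪W y, graphNormal A g (A y 0)⟫_ℝ ∂Ω.arcLength :=
    integral_congr_ae ((ae_outwardNormal_eq hg h).mono fun y hy => by simp only [hy])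
  have hm : Measurable fun y => ⟪W y, graphNormal A g (A y 0)⟫_ℝ :=
    hW.continuous.measurable.inner
      ((measurable_graphNormal A g).comp (continuous_coord A 0).measurable)
  rw [right, arcLength_restrict_ball hg h, setIntegral_eq_integral_of_forall_compl_eq_zero
    fun y hy => by rw [hW0 y hy, inner_zero_left],
    integral_map hgm.aemeasurable hm.aestronglyMeasurable]
  have hd : (volume.withDensity (graphDensity g)) = volume.withDensity
      fun s => ((Real.toNNReal √(1 + deriv g s ^ 2) : ℝ≥0) : ℝ≥0∞) := rfl
  have hρm : Measurable fun s => Real.toNNReal √(1 + deriv g s ^ 2) := by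
    have := measurable_deriv g
    fun_prop
  rw [hd, integral_withDensity_eq_integral_smul hρm]
  refine integral_congr_ae (.of_forall fun s => ?_)
  -- The density √(1 + g'²) cancels the normalizing factor of the unit normal.
  have hρ := one_le_sqrt_one_add_sq (deriv g s)
  simp only
  rw [real_inner_comm, (coord_graphMap A g s).1, inner_graphNormal, NNReal.smul_def,
    Real.coe_toNNReal _ (Real.sqrt_nonneg _), smul_eq_mul, ← mul_assoc,
    mul_inv_cancel₀ (by positivity), one_mul]
  rfl

/-- Both sides vanish: the frontier does not meet the open set `K`, and each partial derivative of a
compactly supported field has integral zero over the plane. -/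
theorem integral_divergence_of_tsupport_subset {W : Plane → Plane} (hW : ContDiff ℝ 1 W)
    (hc : HasCompactSupport W) (hs : tsupport W ⊆ Ω.K) :
    ∫ y in Ω.K, divergence W y = ∫ y, ⟪W y, outwardNormal Ω.K y⟫_ℝ ∂Ω.arcLength := by
  have h1 : ∫ y, ⟪W y, outwardNormal Ω.K y⟫_ℝ ∂Ω.arcLength = 0 := by
    refine integral_eq_zero_of_ae (Ω.ae_mem_frontier.mono fun y hy => ?_)
    rw [Ω.isOpen.frontier_eq] at hy
    simp [image_eq_zero_of_notMem_tsupport fun h' => hy.2 (hs h')]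
  rw [h1, setIntegral_eq_integral_of_forall_compl_eq_zero
    fun y hy => divergence_eq_zero_of_notMem_tsupport fun h' => hy (hs h')]
  have hint : ∀ i : Fin 2,
      Integrable fun y => (fderiv ℝ W y (EuclideanSpace.single i 1)) i := by
    intro i
    have := hW.continuous_fderiv one_ne_zero
    refine Continuous.integrable_of_hasCompactSupport (by fun_prop) ?_
    exact HasCompactSupport.comp_left (g := fun y : Plane => y i) (hc.fderiv_apply ℝ _) rfl
  simp only [divergence]
  rw [integral_finsetSum _ fun i _ => hint i]
  refine Finset.sum_eq_zero fun i _ => ?_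
  have hf : ∀ y, fderiv ℝ (fun y => W y i) y (EuclideanSpace.single i 1) =
      (fderiv ℝ W y (EuclideanSpace.single i 1)) i := fun y =>
    congrArg (fun T : Plane →L[ℝ] ℝ => T (EuclideanSpace.single i 1))
      ((EuclideanSpace.proj i : Plane →L[ℝ] ℝ).hasFDerivAt.comp y
        (hW.differentiable one_ne_zero y).hasFDerivAt).fderiv
  have := integral_mul_fderiv_eq_neg_fderiv_mul_of_integrable (μ := (volume : Measure Plane))
    (f := fun _ => (1 : ℝ)) (g := fun y => W y i) (v := EuclideanSpace.single i 1)
    (by simp) (by simpa [hf] using hint i)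
    (by
      simp only [one_mul]
      exact Continuous.integrable_of_hasCompactSupport (by fun_prop)
        (HasCompactSupport.comp_left (g := fun y : Plane => y i) hc rfl))
    (fun y _ => differentiableAt_const _)
    (fun y _ => ((EuclideanSpace.proj i : Plane →L[ℝ] ℝ).differentiableAt.comp y
        (hW.differentiable one_ne_zero y)))
  simpa [hf] using this

variable (Ω)

theorem isCompact_closure : IsCompact (closure Ω.K) := Ω.isBounded.isCompact_closure

/-- The normal is defined by choice, so measurability comes from the charts: finitely many balls
cover the frontier, and on each the normal agrees almost everywhere with a measurable graph normal.
-/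
theorem aestronglyMeasurable_outwardNormal :
    AEStronglyMeasurable (outwardNormal Ω.K) Ω.arcLength := by
  choose! A g L r hr hg h using Ω.lipschitz
  have hcomp : IsCompact (frontier Ω.K) :=
    Ω.isCompact_closure.of_isClosed_subset isClosed_frontier frontier_subset_closure
  obtain ⟨t, ht, htc⟩ := hcomp.elim_nhds_subcover (fun x => ball x (r x))
    fun x hx => ball_mem_nhds x (hr x hx)
  have h1 : Ω.arcLength.restrict (⋃ x : t, ball (x : Plane) (r x)) = Ω.arcLength := by
    rw [Measure.restrict_eq_self_of_ae_mem]
    filter_upwards [Ω.ae_mem_frontier] with y hy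
    simpa using htc hy
  rw [← h1, aestronglyMeasurable_iUnion_iff]
  intro x
  have hx := ht x x.2
  exact ⟨fun y => graphNormal (A x) (g x) (A x y 0), ((measurable_graphNormal _ _).comp
    (continuous_coord _ 0).measurable).stronglyMeasurable, ae_outwardNormal_eq (hg x hx) (h x hx)⟩

instance : IsFiniteMeasure (volume.restrict Ω.K) :=
  ⟨by simpa using Ω.isBounded.measure_lt_top⟩

theorem memLp_of_continuous {E : Type*} [NormedAddCommGroup E] [SecondCountableTopology E]
    {f : Plane → E} (hf : Continuous f) (p : ℝ≥0∞) :
    MemLp f p (volume.restrict Ω.K) := by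
  obtain ⟨C, hC⟩ := Ω.isCompact_closure.exists_bound_of_continuousOn hf.continuousOn
  refine MemLp.of_bound hf.aestronglyMeasurable C ?_
  filter_upwards [ae_restrict_mem Ω.isOpen.measurableSet] with y hy
  exact hC y (subset_closure hy)

theorem memLp_arcLength_of_continuous {E : Type*} [NormedAddCommGroup E]
    [SecondCountableTopology E] {f : Plane → E} (hf : Continuous f) (p : ℝ≥0∞) :
    MemLp f p Ω.arcLength := by
  obtain ⟨C, hC⟩ := Ω.isCompact_closure.exists_bound_of_continuousOn hf.continuousOn
  refine MemLp.of_bound hf.aestronglyMeasurable C ?_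
  filter_upwards [Ω.ae_mem_frontier] with y hy
  exact hC y (frontier_subset_closure hy)

theorem memLp_inner_outwardNormal {W : Plane → Plane} (hW : Continuous W) (p : ℝ≥0∞) :
    MemLp (fun y => ⟪W y, outwardNormal Ω.K y⟫_ℝ) p Ω.arcLength := by
  refine (Ω.memLp_arcLength_of_continuous hW p).mono
    (hW.aestronglyMeasurable.inner Ω.aestronglyMeasurable_outwardNormal) (.of_forall fun y => ?_)
  refine (norm_inner_le_norm _ _).trans ?_
  exact mul_le_of_le_one_right (norm_nonneg _) (norm_outwardNormal_le _ _)

/-- The divergence theorem on a curvilinear polygon. -/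
theorem integral_divergence {W : Plane → Plane} (hW : ContDiff ℝ 1 W) :
    ∫ y in Ω.K, divergence W y = ∫ y, ⟪W y, outwardNormal Ω.K y⟫_ℝ ∂Ω.arcLength := by
  have hloc : ∀ x ∈ closure Ω.K, ∃ r > 0, ∀ V : Plane → Plane, ContDiff ℝ 1 V →
      HasCompactSupport V → tsupport V ⊆ ball x r →
      ∫ y in Ω.K, divergence V y = ∫ y, ⟪V y, outwardNormal Ω.K y⟫_ℝ ∂Ω.arcLength := by
    intro x hx
    by_cases hxK : x ∈ Ω.K
    · obtain ⟨r, hr, hr'⟩ := Metric.isOpen_iff.1 Ω.isOpen x hxK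
      exact ⟨r, hr, fun V hV hc hs => integral_divergence_of_tsupport_subset hV hc (hs.trans hr')⟩
    · have hf : x ∈ frontier Ω.K := by
        rw [Ω.isOpen.frontier_eq]
        exact ⟨hx, hxK⟩
      obtain ⟨A, g, L, r, hr, hg, h⟩ := Ω.lipschitz x hf
      exact ⟨r, hr, fun V hV hc hs => integral_divergence_of_chart hg h hV hc hs⟩
  choose! r hr hloc using hloc
  obtain ⟨t, ht, htc⟩ := Ω.isCompact_closure.elim_nhds_subcover (fun x => ball x (r x))
    fun x hx => ball_mem_nhds x (hr x hx)
  obtain ⟨ρ, hρ⟩ := SmoothPartitionOfUnity.exists_isSubordinate (modelWithCornersSelf ℝ Plane)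
    (isClosed_closure (s := Ω.K)) (fun x : t => ball (x : Plane) (r x)) (fun _ => isOpen_ball)
    (htc.trans (iUnion₂_subset fun x hx => subset_iUnion_of_subset ⟨x, hx⟩ subset_rfl))
  have hρc : ∀ i, ContDiff ℝ 1 (ρ i) := fun i => (ρ i).contMDiff.contDiff.of_le (by simp)
  have hρ1 : ∀ y ∈ closure Ω.K, ∑ i, ρ i y = 1 := by
    intro y hy
    rw [← finsum_eq_sum_of_fintype]
    exact ρ.sum_eq_one hy
  set V : t → Plane → Plane := fun i y => ρ i y • W y with hV_def
  have hV : ∀ i, ContDiff ℝ 1 (V i) := fun i => (hρc i).smul hW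
  have hVs : ∀ i, tsupport (V i) ⊆ ball (i : Plane) (r i) := fun i =>
    (closure_mono (Function.support_smul_subset_left _ _)).trans (hρ i)
  have hVc : ∀ i, HasCompactSupport (V i) := fun i =>
    (isBounded_ball.subset (hVs i)).isCompact_closure.of_isClosed_subset (isClosed_tsupport _)
      subset_closure
  have hsum : ∀ y ∈ closure Ω.K, ∑ i, V i y = W y := fun y hy => by
    simp only [hV_def]
    rw [← Finset.sum_smul, hρ1 y hy, one_smul]
  have hdiv : ∀ y ∈ Ω.K, divergence W y = ∑ i, divergence (V i) y := by
    intro y hy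
    -- The partition sums to 1 only on the closure of `K`; openness of `K` makes the identity hold
    -- near `y`, as differentiation requires.
    have h1 : W =ᶠ[𝓝 y] fun z => ∑ i, V i z := by
      filter_upwards [Ω.isOpen.mem_nhds hy] with z hz
      exact (hsum z (subset_closure hz)).symm
    simp only [divergence]
    rw [h1.fderiv_eq, fderiv_fun_sum fun i _ => (hV i).differentiable one_ne_zero y,
      Finset.sum_comm]
    simp
  rw [setIntegral_congr_fun Ω.isOpen.measurableSet hdiv, integral_finsetSum]
  · rw [Finset.sum_congr rfl fun (i : t) _ => hloc i (ht i i.2) (V i) (hV i) (hVc i) (hVs i),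
      ← integral_finsetSum]
    · refine integral_congr_ae (Ω.ae_mem_frontier.mono fun y hy => ?_)
      simp only
      rw [← sum_inner, hsum y (frontier_subset_closure hy)]
    · exact fun i _ => (Ω.memLp_inner_outwardNormal (hV i).continuous 1).integrable le_rfl
  · exact fun i _ => (Ω.memLp_of_continuous (continuous_divergence (hV i)) 1).integrable le_rfl

end CurvilinearPolygon

/-! ### Polynomial functions -/

theorem hasFDerivAt_polyFun (P : MvPolynomial (Fin 2) ℝ) (x : Plane) :
    HasFDerivAt (polyFun P)
      (∑ i, polyFun (pderiv i P) x • (EuclideanSpace.proj i : Plane →L[ℝ] ℝ)) x := by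
  induction P using MvPolynomial.induction_on with
  | C a =>
    have : polyFun (C a) = fun _ => a := by ext; simp [polyFun]
    rw [this]
    simpa [polyFun] using hasFDerivAt_const a x
  | add p q hp hq =>
    have h : polyFun (p + q) = fun x => polyFun p x + polyFun q x := by ext; simp [polyFun]
    rw [h]
    refine (hp.add hq).congr_fderiv ?_
    simp [polyFun, add_smul, Finset.sum_add_distrib]
  | mul_X p n hp =>
    have h : polyFun (p * X n) = fun x => polyFun p x * x n := by ext; simp [polyFun]
    rw [h]
    refine (hp.mul (EuclideanSpace.proj n : Plane →L[ℝ] ℝ).hasFDerivAt).congr_fderiv ?_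
    ext e
    fin_cases n <;> simp [polyFun, pderiv_X, Fin.sum_univ_two] <;> ring

theorem fderiv_polyFun_single (P : MvPolynomial (Fin 2) ℝ) (x : Plane) (i : Fin 2) :
    fderiv ℝ (polyFun P) x (EuclideanSpace.single i 1) = polyFun (pderiv i P) x := by
  rw [(hasFDerivAt_polyFun P x).fderiv]
  fin_cases i <;> simp [Fin.sum_univ_two]

theorem contDiff_polyFun (P : MvPolynomial (Fin 2) ℝ) : ContDiff ℝ ∞ (polyFun P) := by
  induction P using MvPolynomial.induction_on with
  | C a =>
    have : polyFun (C a) = fun _ => a := by ext; simp [polyFun]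
    rw [this]
    exact contDiff_const
  | add p q hp hq =>
    have h : polyFun (p + q) = fun x => polyFun p x + polyFun q x := by ext; simp [polyFun]
    rw [h]
    exact hp.add hq
  | mul_X p n hp =>
    have h : polyFun (p * X n) = fun x => polyFun p x * x n := by ext; simp [polyFun]
    rw [h]
    exact hp.mul (EuclideanSpace.proj n : Plane →L[ℝ] ℝ).contDiff

theorem polyFun_polyLaplacian (P : MvPolynomial (Fin 2) ℝ) (x : Plane) :
    polyFun (polyLaplacian P) x = ∑ i, polyFun (pderiv i (pderiv i P)) x := by
  simp [polyFun, polyLaplacian]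

/-! ### Gradients and divergences of smooth functions -/

theorem continuous_gradient {ψ : Plane → ℝ} (hψ : ContDiff ℝ 1 ψ) : Continuous (gradient ψ) :=
  (InnerProductSpace.toDual ℝ Plane).symm.continuous.comp (hψ.continuous_fderiv one_ne_zero)

theorem contDiff_gradient {ψ : Plane → ℝ} (hψ : ContDiff ℝ ∞ ψ) :
    ContDiff ℝ ∞ (gradient ψ) :=
  ((InnerProductSpace.toDual ℝ Plane).symm.toContinuousLinearEquiv.contDiff).comp
    (hψ.fderiv_right (m := ∞) (by simp))

theorem gradient_apply (ψ : Plane → ℝ) (x : Plane) (i : Fin 2) :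
    gradient ψ x i = fderiv ℝ ψ x (EuclideanSpace.single i 1) := by
  rw [← inner_gradient_left (𝕜 := ℝ), EuclideanSpace.inner_single_right]
  simp

theorem divergence_smul {ψ : Plane → ℝ} {W : Plane → Plane} (hψ : ContDiff ℝ 1 ψ)
    (hW : ContDiff ℝ 1 W) (x : Plane) :
    divergence (fun y => ψ y • W y) x = ⟪W x, gradient ψ x⟫_ℝ + divergence W x * ψ x := by
  have h := (hψ.differentiable one_ne_zero x).hasFDerivAt.smul
    (hW.differentiable one_ne_zero x).hasFDerivAt
  have h' : fderiv ℝ (fun y => ψ y • W y) x = _ := h.fderiv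
  rw [divergence, h', divergence, PiLp.inner_apply]
  simp [Fin.sum_univ_two, gradient_apply]
  ring

theorem divergence_gradient_polyFun (P : MvPolynomial (Fin 2) ℝ) (x : Plane) :
    divergence (gradient (polyFun P)) x = polyFun (polyLaplacian P) x := by
  rw [polyFun_polyLaplacian, divergence]
  refine Finset.sum_congr rfl fun i _ => ?_
  have hd : DifferentiableAt ℝ (gradient (polyFun P)) x :=
    (contDiff_gradient (contDiff_polyFun P)).differentiable (by simp) x
  have h1 := ((EuclideanSpace.proj i : Plane →L[ℝ] ℝ).hasFDerivAt.comp x hd.hasFDerivAt).fderiv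
  have h2 : ((EuclideanSpace.proj i : Plane →L[ℝ] ℝ) ∘ gradient (polyFun P)) =
      polyFun (pderiv i P) := by
    ext y
    simp [gradient_apply, fderiv_polyFun_single]
  rw [h2] at h1
  rw [← fderiv_polyFun_single, h1]
  rfl

/-! ### Weak derivatives -/

theorem IsTestFunction.apply_eq_zero {K : Set Plane} {φ : Plane → ℝ} (hφ : IsTestFunction K φ)
    {x : Plane} (hx : x ∉ K) : φ x = 0 :=
  image_eq_zero_of_notMem_tsupport fun h => hx (hφ.2.2 h)

theorem IsTestFunction.fderiv_apply {K : Set Plane} {φ : Plane → ℝ} (hφ : IsTestFunction K φ)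
    (e : Plane) : IsTestFunction K fun x => fderiv ℝ φ x e :=
  ⟨(hφ.1.fderiv_right (m := ∞) (by simp)).clm_apply contDiff_const, hφ.2.1.fderiv_apply ℝ e,
    (tsupport_fderiv_apply_subset ℝ e).trans hφ.2.2⟩

theorem setIntegral_mul_fderiv {K : Set Plane} {φ ψ : Plane → ℝ} (hφ : IsTestFunction K φ)
    (hψ : ContDiff ℝ 1 ψ) (e : Plane) :
    ∫ x in K, ψ x * fderiv ℝ φ x e = -∫ x in K, fderiv ℝ ψ x e * φ x := by
  have hφ' := hφ.fderiv_apply e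
  rw [setIntegral_eq_integral_of_forall_compl_eq_zero fun x hx => by
      rw [hφ'.apply_eq_zero hx, mul_zero],
    setIntegral_eq_integral_of_forall_compl_eq_zero fun x hx => by
      rw [hφ.apply_eq_zero hx, mul_zero]]
  have hψ' : Continuous fun x => fderiv ℝ ψ x e :=
    (hψ.continuous_fderiv one_ne_zero).clm_apply continuous_const
  have hψc := hψ.continuous
  have hφc := hφ.1.continuous
  have hφc' := hφ'.1.continuous
  exact integral_mul_fderiv_eq_neg_fderiv_mul_of_integrable
    (Continuous.integrable_of_hasCompactSupport (by fun_prop) hφ.2.1.mul_left)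
    (Continuous.integrable_of_hasCompactSupport (by fun_prop) hφ'.2.1.mul_left)
    (Continuous.integrable_of_hasCompactSupport (by fun_prop) hφ.2.1.mul_left)
    (fun x _ => hψ.differentiable one_ne_zero x)
    (fun x _ => hφ.1.differentiable (by simp) x)

theorem laplacian_eq_sum {φ : Plane → ℝ} (hφ : ContDiff ℝ ∞ φ) (x : Plane) :
    Laplacian.laplacian φ x = ∑ i : Fin 2,
      fderiv ℝ (fun y => fderiv ℝ φ y (EuclideanSpace.single i 1)) x
        (EuclideanSpace.single i 1) := by
  rw [InnerProductSpace.laplacian_eq_iteratedFDeriv_orthonormalBasis φ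
    (EuclideanSpace.basisFun (Fin 2) ℝ)]
  refine Finset.sum_congr rfl fun i _ => ?_
  have hd : DifferentiableAt ℝ (fderiv ℝ φ) x :=
    (hφ.fderiv_right (m := ∞) (by simp)).differentiable (by simp) x
  rw [iteratedFDeriv_two_apply, fderiv_clm_apply hd (differentiableAt_const _)]
  simp

namespace CurvilinearPolygon

variable {Ω : CurvilinearPolygon}

theorem integrable_mul_of_memLp {u φ : Plane → ℝ} (hu : MemLp u 2 (volume.restrict Ω.K))
    (hφ : Continuous φ) : Integrable (fun x => u x * φ x) (volume.restrict Ω.K) :=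
  hu.integrable_mul (Ω.memLp_of_continuous hφ 2)

/-- The fundamental lemma of the calculus of variations. It makes the choices in `weakGrad` and
`weakLaplacian` harmless. -/
theorem ae_eq_zero_of_forall_test {f : Plane → ℝ} (hf : MemLp f 2 (volume.restrict Ω.K))
    (h : ∀ φ, IsTestFunction Ω.K φ → ∫ x in Ω.K, f x * φ x = 0) :
    ∀ᵐ x ∂volume.restrict Ω.K, f x = 0 := by
  rw [ae_restrict_iff' Ω.isOpen.measurableSet]
  have hint : IntegrableOn f Ω.K := hf.integrable (by norm_num)
  refine Ω.isOpen.ae_eq_zero_of_integral_contDiff_smul_eq_zero hint.locallyIntegrableOn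
    fun φ h1 h2 h3 => ?_
  have hφ : IsTestFunction Ω.K φ := ⟨h1, h2, h3⟩
  rw [← h φ hφ, setIntegral_eq_integral_of_forall_compl_eq_zero fun x hx => by
      rw [hφ.apply_eq_zero hx, mul_zero]]
  simp [mul_comm]

theorem weakGrad_ae_eq {u : Plane → ℝ} {G : Plane → Plane} (h : HasWeakGrad Ω.K u G) :
    weakGrad Ω.K u =ᵐ[volume.restrict Ω.K] G := by
  have hex : ∃ G, HasWeakGrad Ω.K u G := ⟨G, h⟩
  have hw : HasWeakGrad Ω.K u (weakGrad Ω.K u) := by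
    rw [weakGrad, dif_pos hex]
    exact hex.choose_spec
  have key : ∀ i : Fin 2, ∀ᵐ x ∂volume.restrict Ω.K,
      ⟪weakGrad Ω.K u x - G x, EuclideanSpace.single i (1 : ℝ)⟫_ℝ = 0 := by
    intro i
    refine ae_eq_zero_of_forall_test ((hw.1.sub h.1).inner_const _) fun φ hφ => ?_
    have h1 := hw.2 φ hφ (EuclideanSpace.single i 1)
    rw [h.2 φ hφ, neg_inj] at h1
    simp only [inner_sub_left, sub_mul]
    rw [integral_sub, h1, sub_self]
    · exact integrable_mul_of_memLp (hw.1.inner_const _) hφ.1.continuous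
    · exact integrable_mul_of_memLp (h.1.inner_const _) hφ.1.continuous
  filter_upwards [key 0, key 1] with x h0 h1
  ext i
  fin_cases i
  · simpa [EuclideanSpace.inner_single_right, sub_eq_zero] using h0
  · simpa [EuclideanSpace.inner_single_right, sub_eq_zero] using h1

theorem _root_.MemH1.hasWeakGrad {K : Set Plane} {u : Plane → ℝ} (h : MemH1 K u) :
    HasWeakGrad K u (weakGrad K u) := by
  rw [weakGrad, dif_pos h.2]
  exact h.2.choose_spec

theorem weakLaplacian_ae_eq {u F : Plane → ℝ} (h : HasWeakLaplacian Ω.K u F) :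
    weakLaplacian Ω.K u =ᵐ[volume.restrict Ω.K] F := by
  have hex : ∃ F, HasWeakLaplacian Ω.K u F := ⟨F, h⟩
  have hw : HasWeakLaplacian Ω.K u (weakLaplacian Ω.K u) := by
    rw [weakLaplacian, dif_pos hex]
    exact hex.choose_spec
  have key := ae_eq_zero_of_forall_test (hw.1.sub h.1) fun φ hφ => by
    simp only [Pi.sub_apply, sub_mul]
    rw [integral_sub (integrable_mul_of_memLp hw.1 hφ.1.continuous)
      (integrable_mul_of_memLp h.1 hφ.1.continuous), ← hw.2 φ hφ, ← h.2 φ hφ, sub_self]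
  filter_upwards [key] with x hx
  exact sub_eq_zero.1 hx

theorem hasWeakGrad_of_contDiff {ψ : Plane → ℝ} (hψ : ContDiff ℝ 1 ψ) :
    HasWeakGrad Ω.K ψ (gradient ψ) := by
  refine ⟨Ω.memLp_of_continuous (continuous_gradient hψ) 2, fun φ hφ e => ?_⟩
  simp only [inner_gradient_left (𝕜 := ℝ)]
  exact setIntegral_mul_fderiv hφ hψ e

theorem memH1_of_contDiff {ψ : Plane → ℝ} (hψ : ContDiff ℝ 1 ψ) : MemH1 Ω.K ψ :=
  ⟨Ω.memLp_of_continuous hψ.continuous 2, _, hasWeakGrad_of_contDiff hψ⟩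

theorem hasWeakLaplacian_polyFun (P : MvPolynomial (Fin 2) ℝ) :
    HasWeakLaplacian Ω.K (polyFun P) (polyFun (polyLaplacian P)) := by
  refine ⟨Ω.memLp_of_continuous (contDiff_polyFun _).continuous 2, fun φ hφ => ?_⟩
  have h1 : ∀ (Q : MvPolynomial (Fin 2) ℝ), ContDiff ℝ 1 (polyFun Q) := fun Q =>
    (contDiff_polyFun Q).of_le (by simp)
  simp only [laplacian_eq_sum hφ.1, polyFun_polyLaplacian, Finset.mul_sum, Finset.sum_mul]
  rw [integral_finsetSum, integral_finsetSum]
  · refine Finset.sum_congr rfl fun i _ => ?_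
    have hφ' := hφ.fderiv_apply (EuclideanSpace.single i 1)
    rw [setIntegral_mul_fderiv hφ' (h1 P)]
    simp only [fderiv_polyFun_single]
    rw [setIntegral_mul_fderiv hφ (h1 _), neg_neg]
    simp only [fderiv_polyFun_single]
  · exact fun i _ => integrable_mul_of_memLp (Ω.memLp_of_continuous (h1 _).continuous 2)
      hφ.1.continuous
  · exact fun i _ => integrable_mul_of_memLp (Ω.memLp_of_continuous (h1 _).continuous 2)
      ((hφ.fderiv_apply _).fderiv_apply _).1.continuous

theorem _root_.HasWeakGrad.sub {u w : Plane → ℝ} {G H : Plane → Plane}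
    (hu : MemLp u 2 (volume.restrict Ω.K)) (hw : MemLp w 2 (volume.restrict Ω.K))
    (hG : HasWeakGrad Ω.K u G) (hH : HasWeakGrad Ω.K w H) :
    HasWeakGrad Ω.K (u - w) (G - H) := by
  refine ⟨hG.1.sub hH.1, fun φ hφ e => ?_⟩
  have hφ' := (hφ.fderiv_apply e).1.continuous
  have hi : ∀ {G : Plane → Plane}, MemLp G 2 (volume.restrict Ω.K) →
      Integrable (fun x => ⟪G x, e⟫_ℝ * φ x) (volume.restrict Ω.K) := fun hG =>
    integrable_mul_of_memLp (hG.inner_const e) hφ.1.continuous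
  simp only [Pi.sub_apply, sub_mul, inner_sub_left]
  rw [integral_sub (integrable_mul_of_memLp hu hφ') (integrable_mul_of_memLp hw hφ'),
    integral_sub (hi hG.1) (hi hH.1), hG.2 φ hφ, hH.2 φ hφ]
  ring

theorem _root_.MemH1.sub {u w : Plane → ℝ} (hu : MemH1 Ω.K u) (hw : MemH1 Ω.K w) :
    MemH1 Ω.K (u - w) :=
  ⟨hu.1.sub hw.1, _, hu.hasWeakGrad.sub hu.1 hw.1 hw.hasWeakGrad⟩

theorem _root_.HasWeakLaplacian.sub {u w F H : Plane → ℝ}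
    (hu : MemLp u 2 (volume.restrict Ω.K)) (hw : MemLp w 2 (volume.restrict Ω.K))
    (hF : HasWeakLaplacian Ω.K u F) (hH : HasWeakLaplacian Ω.K w H) :
    HasWeakLaplacian Ω.K (u - w) (F - H) := by
  refine ⟨hF.1.sub hH.1, fun φ hφ => ?_⟩
  have hφ' : Continuous (Laplacian.laplacian φ) := by
    rw [funext (laplacian_eq_sum hφ.1)]
    exact continuous_finsetSum _ fun i _ =>
      ((hφ.fderiv_apply _).fderiv_apply _).1.continuous
  simp only [Pi.sub_apply, sub_mul]
  rw [integral_sub (integrable_mul_of_memLp hu hφ') (integrable_mul_of_memLp hw hφ'),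
    integral_sub (integrable_mul_of_memLp hF.1 hφ.1.continuous)
      (integrable_mul_of_memLp hH.1 hφ.1.continuous), hF.2 φ hφ, hH.2 φ hφ]

end CurvilinearPolygon

/-! ### Green's formula for traces and normal derivatives -/

theorem tendsto_integral_inner {α E : Type*} [MeasurableSpace α] {μ : Measure α}
    [NormedAddCommGroup E] [InnerProductSpace ℝ E] {F : ℕ → α → E} {G H : α → E}
    (hF : ∀ k, MemLp (F k) 2 μ) (hG : MemLp G 2 μ) (hH : MemLp H 2 μ)
    (h : Tendsto (fun k => eLpNorm (fun x => F k x - G x) 2 μ) atTop (𝓝 0)) :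
    Tendsto (fun k => ∫ x, ⟪F k x, H x⟫_ℝ ∂μ) atTop (𝓝 (∫ x, ⟪G x, H x⟫_ℝ ∂μ)) := by
  have key : ∀ {G : α → E} (hG : MemLp G 2 μ),
      ⟪hG.toLp G, hH.toLp H⟫_ℝ = ∫ x, ⟪G x, H x⟫_ℝ ∂μ := by
    intro G hG
    refine (L2.inner_def (𝕜 := ℝ) (hG.toLp G) (hH.toLp H)).trans (integral_congr_ae ?_)
    filter_upwards [hG.coeFn_toLp, hH.coeFn_toLp] with x h1 h2
    rw [h1, h2]
  have := ((Lp.tendsto_Lp_iff_tendsto_eLpNorm'' F hF G hG).2 h).inner (𝕜 := ℝ)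
    (tendsto_const_nhds (x := hH.toLp H))
  simpa only [key] using this

theorem tendsto_integral_mul {α : Type*} [MeasurableSpace α] {μ : Measure α}
    {F : ℕ → α → ℝ} {G H : α → ℝ}
    (hF : ∀ k, MemLp (F k) 2 μ) (hG : MemLp G 2 μ) (hH : MemLp H 2 μ)
    (h : Tendsto (fun k => eLpNorm (fun x => F k x - G x) 2 μ) atTop (𝓝 0)) :
    Tendsto (fun k => ∫ x, F k x * H x ∂μ) atTop (𝓝 (∫ x, G x * H x ∂μ)) := by
  simpa [mul_comm] using tendsto_integral_inner hF hG hH h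

theorem integrable_inner_of_memLp {α E : Type*} [MeasurableSpace α] {μ : Measure α}
    [NormedAddCommGroup E] [InnerProductSpace ℝ E] {G H : α → E}
    (hG : MemLp G 2 μ) (hH : MemLp H 2 μ) : Integrable (fun x => ⟪G x, H x⟫_ℝ) μ := by
  refine (L2.integrable_inner (𝕜 := ℝ) (hG.toLp G) (hH.toLp H)).congr ?_
  filter_upwards [hG.coeFn_toLp, hH.coeFn_toLp] with x h1 h2
  rw [h1, h2]

theorem integrable_mul_of_memLp_two {α : Type*} [MeasurableSpace α] {μ : Measure α}
    {G H : α → ℝ} (hG : MemLp G 2 μ) (hH : MemLp H 2 μ) : Integrable (fun x => G x * H x) μ :=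
  hG.integrable_mul hH

namespace CurvilinearPolygon

variable {Ω : CurvilinearPolygon}

/-- The divergence theorem for the field ψ W. -/
theorem green_of_contDiff {ψ : Plane → ℝ} {W : Plane → Plane} (hψ : ContDiff ℝ 1 ψ)
    (hW : ContDiff ℝ 1 W) :
    ∫ y, ψ y * ⟪W y, outwardNormal Ω.K y⟫_ℝ ∂Ω.arcLength =
      (∫ y in Ω.K, ⟪gradient ψ y, W y⟫_ℝ) + ∫ y in Ω.K, ψ y * divergence W y := by
  have h := Ω.integral_divergence (hψ.smul hW)
  have hd : ∀ y, divergence (ψ • W) y = ⟪gradient ψ y, W y⟫_ℝ + ψ y * divergence W y := by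
    intro y
    rw [real_inner_comm, mul_comm]
    exact divergence_smul hψ hW y
  simp only [hd, Pi.smul_apply', real_inner_smul_left] at h
  rw [← h, integral_add]
  · exact integrable_inner_of_memLp (Ω.memLp_of_continuous (continuous_gradient hψ) 2)
      (Ω.memLp_of_continuous hW.continuous 2)
  · exact integrable_mul_of_memLp_two (Ω.memLp_of_continuous hψ.continuous 2)
      (Ω.memLp_of_continuous (continuous_divergence hW) 2)

/-- Green's formula for an `H¹` function with a trace and a smooth vector field. -/
theorem HasTrace.green {u f : Plane → ℝ} (h : Ω.HasTrace u f) {W : Plane → Plane}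
    (hW : ContDiff ℝ 1 W) :
    ∫ y, f y * ⟪W y, outwardNormal Ω.K y⟫_ℝ ∂Ω.arcLength =
      (∫ y in Ω.K, ⟪weakGrad Ω.K u y, W y⟫_ℝ) + ∫ y in Ω.K, u y * divergence W y := by
  obtain ⟨hu, hf, ψ, hψ, h1, h2, h3⟩ := h
  have hψ1 : ∀ k, ContDiff ℝ 1 (ψ k) := fun k => (hψ k).of_le (by simp)
  have l1 := tendsto_integral_mul (fun k => Ω.memLp_of_continuous (hψ1 k).continuous 2) hu.1
    (Ω.memLp_of_continuous (continuous_divergence hW) 2) h1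
  have l2 := tendsto_integral_inner
    (fun k => Ω.memLp_of_continuous (continuous_gradient (hψ1 k)) 2) hu.hasWeakGrad.1
    (Ω.memLp_of_continuous hW.continuous 2) h2
  have l3 := tendsto_integral_mul
    (fun k => Ω.memLp_arcLength_of_continuous (hψ1 k).continuous 2) hf
    (Ω.memLp_inner_outwardNormal hW.continuous 2) h3
  refine tendsto_nhds_unique l3 ?_
  simp only [green_of_contDiff (hψ1 _) hW]
  exact l2.add l1

theorem memLp_weakLaplacian {K : Set Plane} {u : Plane → ℝ} (h : ∃ F, HasWeakLaplacian K u F) :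
    MemLp (weakLaplacian K u) 2 (volume.restrict K) := by
  rw [weakLaplacian, dif_pos h]
  exact h.choose_spec.1

/-- The duality pairing is an ordinary boundary integral if the normal derivative is a square
integrable function. -/
theorem HasNormalDeriv.integral_mul_eq_normalPairing {u h a f : Plane → ℝ}
    (hu : Ω.HasNormalDeriv u h) (ha : Ω.HasTrace a f) :
    ∫ y, h y * f y ∂Ω.arcLength = Ω.normalPairing u a := by
  obtain ⟨hu1, hF, hh, W, hW, h1, h2, h3⟩ := hu
  have hW1 : ∀ k, ContDiff ℝ 1 (W k) := fun k => (hW k).of_le (by simp)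
  have l1 := tendsto_integral_inner (fun k => Ω.memLp_of_continuous (hW1 k).continuous 2)
    hu1.hasWeakGrad.1 ha.1.hasWeakGrad.1 h1
  have l2 := tendsto_integral_mul
    (fun k => Ω.memLp_of_continuous (continuous_divergence (hW1 k)) 2)
    (memLp_weakLaplacian hF) ha.1.1 h2
  have l3 := tendsto_integral_mul
    (fun k => Ω.memLp_inner_outwardNormal (hW1 k).continuous 2) hh ha.2.1 h3
  -- For each `k` the two sequences agree by Green's formula for `a` and the field `W k`.
  refine tendsto_nhds_unique l3 ((l1.add l2).congr fun k => ?_)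
  have := ha.green (hW1 k)
  simp only [mul_comm, real_inner_comm] at this ⊢
  exact this.symm

theorem hasTrace_of_contDiff {ψ : Plane → ℝ} (hψ : ContDiff ℝ ∞ ψ) : Ω.HasTrace ψ ψ := by
  have hψ1 : ContDiff ℝ 1 ψ := hψ.of_le (by simp)
  refine ⟨memH1_of_contDiff hψ1, Ω.memLp_arcLength_of_continuous hψ.continuous 2,
    fun _ => ψ, fun _ => hψ, by simp, ?_, by simp⟩
  have : eLpNorm (fun x => gradient ψ x - weakGrad Ω.K ψ x) 2 (volume.restrict Ω.K) = 0 := by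
    rw [eLpNorm_congr_ae (g := 0), eLpNorm_zero]
    filter_upwards [weakGrad_ae_eq (hasWeakGrad_of_contDiff (Ω := Ω) hψ1)] with x hx
    simp [hx]
  simp [this]

theorem HasTrace.sub_contDiff {u f ψ : Plane → ℝ} (h : Ω.HasTrace u f) (hψ : ContDiff ℝ ∞ ψ) :
    Ω.HasTrace (u - ψ) (f - ψ) := by
  have hψ1 : ContDiff ℝ 1 ψ := hψ.of_le (by simp)
  obtain ⟨hu, hf, χ, hχ, h1, h2, h3⟩ := h
  refine ⟨hu.sub (memH1_of_contDiff hψ1), hf.sub (Ω.memLp_arcLength_of_continuous hψ.continuous 2),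
    fun k => χ k - ψ, fun k => (hχ k).sub hψ, by simpa using h1, ?_, by simpa using h3⟩
  refine h2.congr fun k => eLpNorm_congr_ae ?_
  have h4 := weakGrad_ae_eq (hu.hasWeakGrad.sub hu.1 (memH1_of_contDiff (Ω := Ω) hψ1).1
    (hasWeakGrad_of_contDiff hψ1))
  filter_upwards [h4] with x hx
  have hg : gradient (χ k - ψ) x = gradient (χ k) x - gradient ψ x := by
    simp only [gradient]
    rw [fderiv_sub ((hχ k).differentiable (by simp) x) (hψ.differentiable (by simp) x), map_sub]
  rw [hx, hg, Pi.sub_apply]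
  abel

/-- The gradient terms of the two pairings agree by symmetry, so no regularity at the boundary is
involved. -/
theorem normalPairing_sub_normalPairing {a b F G : Plane → ℝ}
    (ha : HasWeakLaplacian Ω.K a F) (hb : HasWeakLaplacian Ω.K b G) :
    Ω.normalPairing a b - Ω.normalPairing b a =
      (∫ x in Ω.K, F x * b x) - ∫ x in Ω.K, G x * a x := by
  have h1 : ∫ x in Ω.K, weakLaplacian Ω.K a x * b x = ∫ x in Ω.K, F x * b x :=
    integral_congr_ae ((weakLaplacian_ae_eq ha).mono fun x hx => by simp only [hx])
  have h2 : ∫ x in Ω.K, weakLaplacian Ω.K b x * a x = ∫ x in Ω.K, G x * a x :=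
    integral_congr_ae ((weakLaplacian_ae_eq hb).mono fun x hx => by simp only [hx])
  simp only [normalPairing, h1, h2, real_inner_comm]
  ring

/-- Green's formula for the field ∇R. As `u` is harmonic, the pairing with `R` reduces to its
gradient term, which is the one in that formula. -/
theorem HasTrace.green_polyFun {u f : Plane → ℝ} (h : Ω.HasTrace u f)
    (hu : HasWeakLaplacian Ω.K u 0) (R : MvPolynomial (Fin 2) ℝ) :
    (∫ x, f x * Ω.normalDeriv (polyFun R) x ∂Ω.arcLength) - Ω.normalPairing u (polyFun R) =
      ∫ x in Ω.K, u x * polyFun (polyLaplacian R) x := by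
  have hR := contDiff_polyFun R
  have h1 := h.green ((contDiff_gradient hR).of_le (by simp))
  simp only [inner_gradient_left (𝕜 := ℝ), divergence_gradient_polyFun] at h1
  have h2 : ∫ x in Ω.K, weakLaplacian Ω.K u x * polyFun R x = 0 :=
    integral_eq_zero_of_ae ((weakLaplacian_ae_eq hu).mono fun x hx => by simp [hx])
  have h3 : ∫ x in Ω.K, ⟪weakGrad Ω.K u x, weakGrad Ω.K (polyFun R) x⟫_ℝ =
      ∫ x in Ω.K, ⟪weakGrad Ω.K u x, gradient (polyFun R) x⟫_ℝ :=
    integral_congr_ae ((weakGrad_ae_eq (hasWeakGrad_of_contDiff (Ω := Ω)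
      (hR.of_le (by simp)))).mono fun x hx => by simp only [hx])
  simp only [normalDeriv, normalPairing, h1, h2, h3]
  ring

theorem memLp_normalDeriv {U : Plane → ℝ} (hU : ContDiff ℝ 1 U) :
    MemLp (Ω.normalDeriv U) 2 Ω.arcLength := by
  have := Ω.memLp_inner_outwardNormal (continuous_gradient hU) 2
  simp only [inner_gradient_left (𝕜 := ℝ)] at this
  exact this

end CurvilinearPolygon

/-! ### The integration formulas -/

namespace CurvilinearPolygon

variable {Ω : CurvilinearPolygon}

theorem hasWeakLaplacian_sub_polyFun {u : Plane → ℝ} {p P : MvPolynomial (Fin 2) ℝ}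
    (hu : MemH1 Ω.K u) (h : HasWeakLaplacian Ω.K u (polyFun p)) (hP : polyLaplacian P = p) :
    HasWeakLaplacian Ω.K (u - polyFun P) 0 := by
  subst hP
  simpa using h.sub hu.1 (Ω.memLp_of_continuous (contDiff_polyFun P).continuous 2)
    (hasWeakLaplacian_polyFun P)

theorem integral_sub_mul {a b c : Plane → ℝ} (ha : MemLp a 2 (volume.restrict Ω.K))
    (hb : MemLp b 2 (volume.restrict Ω.K)) (hc : MemLp c 2 (volume.restrict Ω.K)) :
    ∫ x in Ω.K, (a - b) x * c x = (∫ x in Ω.K, a x * c x) - ∫ x in Ω.K, b x * c x := by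
  simp only [Pi.sub_apply, sub_mul]
  exact integral_sub (integrable_mul_of_memLp_two ha hc) (integrable_mul_of_memLp_two hb hc)

/-- Green's second formula with a harmonic `w`. -/
theorem integral_mul_eq_normalPairing {v w Φ : Plane → ℝ} (hw : HasWeakLaplacian Ω.K w 0)
    (hΦ : HasWeakLaplacian Ω.K Φ v) :
    ∫ x in Ω.K, v x * w x = Ω.normalPairing Φ w - Ω.normalPairing w Φ := by
  simp [normalPairing_sub_normalPairing hΦ hw]

/-- The boundary integral of a polynomial with a normal derivative, split off. -/
theorem integral_normalDeriv_mul_sub {u f h : Plane → ℝ} {R : MvPolynomial (Fin 2) ℝ}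
    (hu : Ω.HasTrace u f) (hn : Ω.HasNormalDeriv u h) :
    ∫ x, (f x * Ω.normalDeriv (polyFun R) x - polyFun R x * h x) ∂Ω.arcLength =
      (∫ x, f x * Ω.normalDeriv (polyFun R) x ∂Ω.arcLength) - Ω.normalPairing u (polyFun R) := by
  have hR := contDiff_polyFun R
  rw [← hn.integral_mul_eq_normalPairing (hasTrace_of_contDiff hR), integral_sub
    (integrable_mul_of_memLp_two hu.2.1 (memLp_normalDeriv (hR.of_le (by simp))))
    (integrable_mul_of_memLp_two (Ω.memLp_arcLength_of_continuous hR.continuous 2) hn.2.2.1)]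
  simp only [mul_comm]

/-- Green's second identity for the harmonic function `v - P` and `R`. It also supplies both mixed
terms of the general formula. -/
theorem integral_mul_polyFun {v f : Plane → ℝ} {p P r R : MvPolynomial (Fin 2) ℝ}
    (hv : HasWeakLaplacian Ω.K v (polyFun p)) (hf : Ω.HasTrace v f)
    (hP : polyLaplacian P = p) (hR : polyLaplacian R = r) :
    ∫ x in Ω.K, v x * polyFun r x =
      ((∫ x, (f x - polyFun P x) * Ω.normalDeriv (polyFun R) x ∂Ω.arcLength)
        - Ω.normalPairing (v - polyFun P) (polyFun R))
      + ∫ x in Ω.K, polyFun P x * polyFun r x := by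
  have h := (hf.sub_contDiff (contDiff_polyFun P)).green_polyFun
    (hasWeakLaplacian_sub_polyFun hf.1 hv hP) R
  have hc : ∀ Q : MvPolynomial (Fin 2) ℝ, MemLp (polyFun Q) 2 (volume.restrict Ω.K) := fun Q =>
    Ω.memLp_of_continuous (contDiff_polyFun Q).continuous 2
  rw [hR, integral_sub_mul hf.1.1 (hc P) (hc r)] at h
  simp only [Pi.sub_apply] at h
  linarith

theorem integral_mul_general {v w f g Φ : Plane → ℝ} {p q P Q Ps Qs : MvPolynomial (Fin 2) ℝ}
    (hv : HasWeakLaplacian Ω.K v (polyFun p)) (hf : Ω.HasTrace v f)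
    (hw : HasWeakLaplacian Ω.K w (polyFun q)) (hg : Ω.HasTrace w g)
    (hP : polyLaplacian P = p) (hQ : polyLaplacian Q = q)
    (hPs : polyLaplacian Ps = P) (hQs : polyLaplacian Qs = Q)
    (hΦ : HasWeakLaplacian Ω.K Φ (v - polyFun P)) :
    ∫ x in Ω.K, v x * w x =
      (Ω.normalPairing Φ (w - polyFun Q) - Ω.normalPairing (w - polyFun Q) Φ)
      + ((∫ x, Ω.normalDeriv (polyFun Qs) x * (f x - polyFun P x) ∂Ω.arcLength)
          - Ω.normalPairing (v - polyFun P) (polyFun Qs))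
      + ((∫ x, Ω.normalDeriv (polyFun Ps) x * (g x - polyFun Q x) ∂Ω.arcLength)
          - Ω.normalPairing (w - polyFun Q) (polyFun Ps))
      + ∫ x in Ω.K, polyFun P x * polyFun Q x := by
  have hc : ∀ Q : MvPolynomial (Fin 2) ℝ, MemLp (polyFun Q) 2 (volume.restrict Ω.K) := fun Q =>
    Ω.memLp_of_continuous (contDiff_polyFun Q).continuous 2
  -- The integrals of v Q and w P each contain one copy of ∫ P Q. Expanding (v - P)(w - Q)
  -- contributes -∫ P Q when solved for ∫ v w, so exactly one copy remains.
  have h1 := integral_mul_polyFun hv hf hP hQs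
  have h2 := integral_mul_polyFun hw hg hQ hPs
  have h3 := integral_mul_eq_normalPairing (hasWeakLaplacian_sub_polyFun hg.1 hw hQ) hΦ
  rw [integral_sub_mul hf.1.1 (hc P) (hg.1.1.sub (hc Q))] at h3
  simp only [mul_comm _ ((w - polyFun Q) _)] at h3
  rw [integral_sub_mul hg.1.1 (hc Q) hf.1.1, integral_sub_mul hg.1.1 (hc Q) (hc P)] at h3
  simp only [mul_comm (Ω.normalDeriv _ _)]
  simp only [mul_comm (w _) (v _), mul_comm (polyFun Q _) (v _),
    mul_comm (polyFun Q _) (polyFun P _)] at h2 h3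
  linarith

end CurvilinearPolygon

theorem mainTheorem2 (Ω : CurvilinearPolygon) (m : ℕ) :
    -- the general formula
    (∀ (v w f g Φ : Plane → ℝ) (p q P Q Ps Qs : MvPolynomial (Fin 2) ℝ),
      Ω.MemV m v → HasWeakLaplacian Ω.K v (polyFun p) → Ω.HasTrace v f →
      Ω.MemV m w → HasWeakLaplacian Ω.K w (polyFun q) → Ω.HasTrace w g →
      polyLaplacian P = p → polyLaplacian Q = q →
      polyLaplacian Ps = P → polyLaplacian Qs = Q →
      MemH1 Ω.K Φ → HasWeakLaplacian Ω.K Φ (v - polyFun P) →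
      -- the normal derivatives of `Φ`, `v - P`, `w - Q` as functionals on traces
      (∫ x in Ω.K, v x * w x =
        (Ω.normalPairing Φ (w - polyFun Q) - Ω.normalPairing (w - polyFun Q) Φ)
        + ((∫ x, Ω.normalDeriv (polyFun Qs) x * (f x - polyFun P x) ∂Ω.arcLength)
            - Ω.normalPairing (v - polyFun P) (polyFun Qs))
        + ((∫ x, Ω.normalDeriv (polyFun Ps) x * (g x - polyFun Q x) ∂Ω.arcLength)
            - Ω.normalPairing (w - polyFun Q) (polyFun Ps))
        + ∫ x in Ω.K, polyFun P x * polyFun Q x) ∧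
      -- the normal derivatives of `Φ`, `v - P`, `w - Q` as functions on the boundary
      (∀ τ nΦ nv nw : Plane → ℝ, Ω.HasTrace Φ τ → Ω.HasNormalDeriv Φ nΦ →
        Ω.HasNormalDeriv (v - polyFun P) nv → Ω.HasNormalDeriv (w - polyFun Q) nw →
        ∫ x in Ω.K, v x * w x =
          (∫ x, (nΦ x * (g x - polyFun Q x) - τ x * nw x) ∂Ω.arcLength)
          + (∫ x, (Ω.normalDeriv (polyFun Qs) x * (f x - polyFun P x)
              - polyFun Qs x * nv x) ∂Ω.arcLength)
          + (∫ x, (Ω.normalDeriv (polyFun Ps) x * (g x - polyFun Q x)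
              - polyFun Ps x * nw x) ∂Ω.arcLength)
          + ∫ x in Ω.K, polyFun P x * polyFun Q x)) ∧
    -- the case of a polynomial second factor
    (∀ (v f : Plane → ℝ) (p P r R : MvPolynomial (Fin 2) ℝ),
      Ω.MemV m v → HasWeakLaplacian Ω.K v (polyFun p) → Ω.HasTrace v f →
      polyLaplacian P = p → polyLaplacian R = r →
      (∫ x in Ω.K, v x * polyFun r x =
        ((∫ x, (f x - polyFun P x) * Ω.normalDeriv (polyFun R) x ∂Ω.arcLength)
          - Ω.normalPairing (v - polyFun P) (polyFun R))
        + ∫ x in Ω.K, polyFun P x * polyFun r x) ∧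
      (∀ nv : Plane → ℝ, Ω.HasNormalDeriv (v - polyFun P) nv →
        ∫ x in Ω.K, v x * polyFun r x =
          (∫ x, ((f x - polyFun P x) * Ω.normalDeriv (polyFun R) x
            - polyFun R x * nv x) ∂Ω.arcLength)
          + ∫ x in Ω.K, polyFun P x * polyFun r x)) ∧
    -- the case of two harmonic functions
    (∀ (v w g Φ : Plane → ℝ),
      Ω.MemV m v → HasWeakLaplacian Ω.K v 0 →
      Ω.MemV m w → HasWeakLaplacian Ω.K w 0 → Ω.HasTrace w g →
      MemH1 Ω.K Φ → HasWeakLaplacian Ω.K Φ v →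
      (∫ x in Ω.K, v x * w x = Ω.normalPairing Φ w - Ω.normalPairing w Φ) ∧
      (∀ τ nΦ nw : Plane → ℝ, Ω.HasTrace Φ τ → Ω.HasNormalDeriv Φ nΦ → Ω.HasNormalDeriv w nw →
        ∫ x in Ω.K, v x * w x =
          (∫ x, nΦ x * g x ∂Ω.arcLength) - ∫ x, τ x * nw x ∂Ω.arcLength)) := by
  refine ⟨fun v w f g Φ p q P Q Ps Qs hvV hv hf hwV hw hg hP hQ hPs hQs hΦ1 hΦ => ?_,
    fun v f p P r R hvV hv hf hP hR => ?_, fun v w g Φ hvV hv hwV hw hg hΦ1 hΦ => ?_⟩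
  · have main := CurvilinearPolygon.integral_mul_general hv hf hw hg hP hQ hPs hQs hΦ
    refine ⟨main, fun τ nΦ nv nw hτ hnΦ hnv hnw => ?_⟩
    -- The differences have traces `f - P` and `g - Q`, so every pairing in `main` becomes an
    -- ordinary integral; L² bounds allow the boundary integrals to be split.
    have tv := hf.sub_contDiff (contDiff_polyFun P)
    have tw := hg.sub_contDiff (contDiff_polyFun Q)
    have h1 := CurvilinearPolygon.integral_normalDeriv_mul_sub (R := Qs) tv hnv
    have h2 := CurvilinearPolygon.integral_normalDeriv_mul_sub (R := Ps) tw hnw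
    have h3 := hnΦ.integral_mul_eq_normalPairing tw
    have h4 := hnw.integral_mul_eq_normalPairing hτ
    have h5 : ∫ x, (nΦ x * (g x - polyFun Q x) - τ x * nw x) ∂Ω.arcLength =
        (∫ x, nΦ x * (g x - polyFun Q x) ∂Ω.arcLength) - ∫ x, τ x * nw x ∂Ω.arcLength :=
      integral_sub (integrable_mul_of_memLp_two hnΦ.2.2.1 tw.2.1)
        (integrable_mul_of_memLp_two hτ.2.1 hnw.2.2.1)
    simp only [Pi.sub_apply] at h1 h2 h3
    simp only [mul_comm (nw _)] at h4
    simp only [mul_comm (Ω.normalDeriv _ _)] at main ⊢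
    rw [main, h5, h1, h2, h3, h4]
  · have main := CurvilinearPolygon.integral_mul_polyFun hv hf hP hR
    refine ⟨main, fun nv hnv => ?_⟩
    have h1 := CurvilinearPolygon.integral_normalDeriv_mul_sub (R := R)
      (hf.sub_contDiff (contDiff_polyFun P)) hnv
    simp only [Pi.sub_apply] at h1
    rw [main, h1]
  · have main := CurvilinearPolygon.integral_mul_eq_normalPairing hw hΦ
    refine ⟨main, fun τ nΦ nw hτ hnΦ hnw => ?_⟩
    have h4 := hnw.integral_mul_eq_normalPairing hτ
    simp only [mul_comm (nw _)] at h4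
    rw [main, hnΦ.integral_mul_eq_normalPairing hg, h4]
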